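/- Let $d\ge 2$, let $B=B^d(1)=\{x\in\mathbb R^d:|x|<1\}$, and let $$F(x,y)=\frac{\sqrt{|y|^2-(|x|^2|y|^2-\langle x,y\rangle^2)}}{1-|x|^2}+\frac{\langle x,y\rangle}{1-|x|^2},\qquad x\in B,\ y\in\mathbb R^d,$$ be the Funk metric. Put $g_x(y,z)=\frac{\langle y,z\rangle}{1-|x|^2}+\frac{\langle x,y\rangle\langle x,z\rangle}{(1-|x|^2)^2}$ and $\beta_x(y)=\frac{\langle x,y\rangle}{1-|x|^2}$. For a Randers metric $F=\sqrt g+\beta$ on $B$ (with $g$ a Riemannian metric, $\beta$ a smooth one-form, and $\|\beta\|_g(x)<1$ for every $x$) let $F^*(x,\alpha)=\sup_{y\ne0}\alpha(y)/F(x,y)$, let $dV_F=(1-\|\beta\|_g^2)^{(d+1)/2}\,dv_g$, and let $$\|u\|_{W^{1,p}_F}=\Big(\int_B F^*(x,Du)^p\,dV_F+\int_B|u|^p\,dV_F\Big)^{1/p},$$ where $Du$ is the distributional derivative. Let $W^{1,p}_F(B)$ be the set of all $u\in W^{1,p}_{\rm loc}(B)$ with $\|u\|_{W^{1,p}_F}<\infty$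 that lie in the closure of $C^\infty(B)$ with respect to this asymmetric norm (for every $\varepsilon>0$ there is $\varphi\in C^\infty(B)$ with $\|u-\varphi\|_{W^{1,p}_F}<\varepsilon$ and $\|\varphi-u\|_{W^{1,p}_F}<\varepsilon$). The space $L^q(B)$ is taken with respect to $dV_F$. A pair $(p,q)\in(1,\infty)\times(1,\infty]$ is called $d$-admissible if $p<d$ and $p<q<\frac{pd}{d-p}$, or $p=d$ and $p<q<\infty$, or $p>d$ and $q=\infty$. Then: 1. $F=\sqrt g+\beta$ on $B\times\mathbb R^d$, and $(B,F)$ is a Randers space. The Riemannian manifold $(B,g)$ is a Hadamard manifold (simply connected, complete, with non-positive sectional curvature). Moreover $\sup_{x\in B}\|\beta\|_g(x)=1$, and the reversibility constant $r_F=\sup_{x\in B}\sup_{y\neq0}\frac{F(x,y)}{F(x,-y)}$ is infinite. 2. For every $d$-admissible pair $(p,q)$, put $t=\frac{p+q}2$ if $q<\infty$ and $t=\frac{p^2}{d}$ if $q=\infty$. Then the function $u(x)=|x|(1-|x|)^{-1/t}$ lies in $W^{1,p}_F(B)$, while $\|u\|_{L^q(B)}=+\infty$. 3. Consequently, for no $d$-admissible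 pair $(p,q)$ is $W^{1,p}_F(B)$ continuously embedded into $L^q(B)$; that is, there is no finite constant $C$ with $\|v\|_{L^q(B)}\le C\|v\|_{W^{1,p}_F}$ for all $v\in W^{1,p}_F(B)$. So a continuous embedding $W^{1,p}_F(M)\hookrightarrow L^q(M)$ for Randers spaces $(M,\sqrt g+\beta)$ with $(M,g)$ a Hadamard manifold can fail when the assumption $\sup_M\|\beta\|_g<1$ (equivalently $r_F<\infty$) is dropped. -/

import Mathlib

open MeasureTheory Set Filter Topology
open scoped NNReal ENNReal ContDiff Matrix

noncomputable section

namespace FunkModel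

/-- The Euclidean space `ℝ^d`; a domain in it is treated as a manifold with one global chart, and
tangent vectors are elements of `ℝ^d`. -/
abbrev E (d : ℕ) : Type := EuclideanSpace ℝ (Fin d)

/-- The open unit ball `B^d(1)`. -/
def unitBall (d : ℕ) : Set (E d) := Metric.ball 0 1

/-- Partial derivative in the `i`-th coordinate direction. -/
def pderiv {d : ℕ} (i : Fin d) (f : E d → ℝ) (x : E d) : ℝ :=
  fderiv ℝ f x (EuclideanSpace.single i 1)

/-! ### Riemannian metrics on a domain

A metric tensor is given by its components `g x i j`, a covector field by its components `β x i`. -/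

/-- `g` is a smooth Riemannian metric on `Ω`. -/
structure IsRiemannianMetric {d : ℕ} (Ω : Set (E d)) (g : E d → Matrix (Fin d) (Fin d) ℝ) :
    Prop where
  isOpen : IsOpen Ω
  smooth : ∀ i j, ContDiffOn ℝ ∞ (fun x => g x i j) Ω
  posDef : ∀ x ∈ Ω, (g x).PosDef

/-- `g_x(y, z)`. -/
def metricForm {d : ℕ} (g : E d → Matrix (Fin d) (Fin d) ℝ) (x y z : E d) : ℝ :=
  ∑ i, ∑ j, g x i j * y i * z j

/-- The co-metric `g*_x(α, α')` on covectors, given by the inverse matrix of `g_x`. -/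
def coMetric {d : ℕ} (g : E d → Matrix (Fin d) (Fin d) ℝ) (x : E d) (α α' : Fin d → ℝ) : ℝ :=
  ∑ i, ∑ j, (g x)⁻¹ i j * α i * α' j

/-- The norm `‖β‖_g(x)` of a one-form. -/
def formNorm {d : ℕ} (g : E d → Matrix (Fin d) (Fin d) ℝ) (β : E d → Fin d → ℝ) (x : E d) : ℝ :=
  Real.sqrt (coMetric g x (β x) (β x))

/-- Christoffel symbols `Γ^k_{ij}` of `g`. -/
def christoffel {d : ℕ} (g : E d → Matrix (Fin d) (Fin d) ℝ) (k i j : Fin d) (x : E d) : ℝ :=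
  (1 / 2) * ∑ l, (g x)⁻¹ k l *
    (pderiv i (fun z => g z j l) x + pderiv j (fun z => g z i l) x - pderiv l (fun z => g z i j) x)

/-- The component `R^l_{kij}` of the curvature tensor: `R(∂_i, ∂_j) ∂_k = ∑ l, R^l_{kij} ∂_l`, where
`R(X, Y) = ∇_X ∇_Y - ∇_Y ∇_X - ∇_[X,Y]`. -/
def riemannTensor {d : ℕ} (g : E d → Matrix (Fin d) (Fin d) ℝ) (l k i j : Fin d) (x : E d) : ℝ :=
  pderiv i (christoffel g l j k) x - pderiv j (christoffel g l i k) x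
    + ∑ m, (christoffel g l i m x * christoffel g m j k x
        - christoffel g l j m x * christoffel g m i k x)

/-- `g(R(X, Y)Y, X)`: the sectional curvature of the plane spanned by `X`, `Y`, times the positive
number `g(X,X) g(Y,Y) - g(X,Y)^2`. -/
def sectionalForm {d : ℕ} (g : E d → Matrix (Fin d) (Fin d) ℝ) (x X Y : E d) : ℝ :=
  ∑ i, ∑ j, ∑ k, ∑ l, ∑ s, g x l s * riemannTensor g l k i j x * X i * Y j * Y k * X s

/-! ### Length and distance -/

/-- `γ`, restricted to `[0,1]`, is a continuous, piecewise smooth curve in `Ω` from `x` to `y`; the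
set `S` contains the finitely many break points. -/
structure IsPiecewiseSmoothCurve {d : ℕ} (Ω : Set (E d)) (x y : E d) (γ : ℝ → E d) : Prop where
  mapsTo : MapsTo γ (Icc 0 1) Ω
  source : γ 0 = x
  target : γ 1 = y
  continuousOn : ContinuousOn γ (Icc 0 1)
  piecewise : ∃ S : Finset ℝ, ∀ a b : ℝ, 0 ≤ a → a < b → b ≤ 1 → (∀ s ∈ S, s ∉ Ioo a b) →
    ContDiffOn ℝ ∞ γ (Icc a b)

/-- Length of a curve with respect to a (Riemannian or Finsler) norm `F(x, y)`. -/
def curveLength {d : ℕ} (F : E d → E d → ℝ) (γ : ℝ → E d) : ℝ≥0∞ :=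
  ∫⁻ t in Icc (0 : ℝ) 1, ENNReal.ofReal (F (γ t) (deriv γ t))

/-- Distance induced on `Ω` by a norm `F(x, y)`. -/
def inducedDist {d : ℕ} (Ω : Set (E d)) (F : E d → E d → ℝ) (x y : E d) : ℝ≥0∞ :=
  ⨅ (γ : ℝ → E d) (_ : IsPiecewiseSmoothCurve Ω x y γ), curveLength F γ

/-- Riemannian distance of `(Ω, g)`. -/
def riemannianDist {d : ℕ} (Ω : Set (E d)) (g : E d → Matrix (Fin d) (Fin d) ℝ) (x y : E d) :
    ℝ≥0∞ :=
  inducedDist Ω (fun z v => Real.sqrt (metricForm g z v v)) x y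

/-- `(Ω, g)` is a Hadamard manifold: a simply connected, complete Riemannian manifold of
non-positive sectional curvature. -/
structure IsHadamard {d : ℕ} (Ω : Set (E d)) (g : E d → Matrix (Fin d) (Fin d) ℝ) : Prop where
  metric : IsRiemannianMetric Ω g
  simplyConnected : SimplyConnectedSpace Ω
  complete : ∀ s : ℕ → E d, (∀ n, s n ∈ Ω) →
    (∀ ε : ℝ≥0∞, 0 < ε → ∃ N, ∀ m ≥ N, ∀ n ≥ N, riemannianDist Ω g (s m) (s n) < ε) →
    ∃ x ∈ Ω, Tendsto (fun n => riemannianDist Ω g (s n) x) atTop (𝓝 0)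
  curvature_nonpos : ∀ x ∈ Ω, ∀ X Y : E d, sectionalForm g x X Y ≤ 0

/-! ### Randers metrics -/

/-- The Randers metric `F(x, y) = √(g_x(y, y)) + β_x(y)`. -/
def randersMetric {d : ℕ} (g : E d → Matrix (Fin d) (Fin d) ℝ) (β : E d → Fin d → ℝ)
    (x y : E d) : ℝ :=
  Real.sqrt (metricForm g x y y) + ∑ i, β x i * y i

/-- `(Ω, √g + β)` is a Randers space: `g` is a Riemannian metric and `β` a smooth one-form with
`‖β‖_g(x) < 1` at every point. -/
structure IsRandersSpace {d : ℕ} (Ω : Set (E d)) (g : E d → Matrix (Fin d) (Fin d) ℝ)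
    (β : E d → Fin d → ℝ) : Prop where
  metric : IsRiemannianMetric Ω g
  smooth : ∀ i, ContDiffOn ℝ ∞ (fun x => β x i) Ω
  formNorm_lt_one : ∀ x ∈ Ω, formNorm g β x < 1

/-- The reversibility constant `r_F = sup_x sup_{y ≠ 0} F(x, y) / F(x, -y)`, in `[0, ∞]`. -/
def reversibility {d : ℕ} (Ω : Set (E d)) (F : E d → E d → ℝ) : ℝ≥0∞ :=
  ⨆ (x ∈ Ω) (y : E d) (_ : y ≠ 0), ENNReal.ofReal (F x y / F x (-y))

/-- The polar transform `F*(x, α) = sup_{y ≠ 0} α(y) / F(x, y)`. It is a non-negative number, so that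
truncating the quotients at `0` does not change the supremum. -/
def polarTransform {d : ℕ} (F : E d → E d → ℝ) (x : E d) (α : Fin d → ℝ) : ℝ≥0∞ :=
  ⨆ (y : E d) (_ : y ≠ 0), ENNReal.ofReal ((∑ i, α i * y i) / F x y)

/-- The Hausdorff volume `dV_F = (1 - ‖β‖_g²)^((d+1)/2) dv_g`, `dv_g = √(det g) dx`, on `Ω`. -/
def randersVolume {d : ℕ} (Ω : Set (E d)) (g : E d → Matrix (Fin d) (Fin d) ℝ)
    (β : E d → Fin d → ℝ) : Measure (E d) :=
  (volume.restrict Ω).withDensity fun x =>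
    ENNReal.ofReal ((1 - formNorm g β x ^ 2) ^ (((d : ℝ) + 1) / 2) * Real.sqrt (g x).det)

/-! ### Sobolev spaces -/

/-- `Du` (by components) is the distributional derivative of `u` on `Ω`; both are locally
integrable. -/
structure HasWeakDeriv {d : ℕ} (Ω : Set (E d)) (u : E d → ℝ) (Du : E d → Fin d → ℝ) : Prop where
  locallyIntegrable : LocallyIntegrableOn u Ω
  locallyIntegrable_deriv : ∀ i, LocallyIntegrableOn (fun x => Du x i) Ω
  integral_eq : ∀ φ : E d → ℝ, ContDiff ℝ ∞ φ → HasCompactSupport φ → tsupport φ ⊆ Ω →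
    ∀ i, ∫ x in Ω, u x * pderiv i φ x = - ∫ x in Ω, Du x i * φ x

/-- `u ∈ W^{1,p}_loc(Ω)`. -/
def MemSobolevLoc {d : ℕ} (Ω : Set (E d)) (p : ℝ) (u : E d → ℝ) : Prop :=
  ∃ Du : E d → Fin d → ℝ, HasWeakDeriv Ω u Du ∧ ∀ K ⊆ Ω, IsCompact K →
    MemLp u (ENNReal.ofReal p) (volume.restrict K) ∧
    ∀ i, MemLp (fun x => Du x i) (ENNReal.ofReal p) (volume.restrict K)

/-- The asymmetric norm `(∫ F*(x, Du)^p dV_F + ∫ |u|^p dV_F)^(1/p)` in `[0, ∞]`, for the Randers metric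
`F = √g + β`. The weak derivative is unique up to null sets, so that the infimum is
over one value; it is `∞` if `u` has no weak derivative. -/
def sobolevNorm {d : ℕ} (Ω : Set (E d)) (g : E d → Matrix (Fin d) (Fin d) ℝ)
    (β : E d → Fin d → ℝ) (p : ℝ) (u : E d → ℝ) : ℝ≥0∞ :=
  ⨅ (Du : E d → Fin d → ℝ) (_ : HasWeakDeriv Ω u Du),
    ((∫⁻ x, polarTransform (randersMetric g β) x (Du x) ^ p ∂(randersVolume Ω g β))
      + ∫⁻ x, ‖u x‖ₑ ^ p ∂(randersVolume Ω g β)) ^ (1 / p)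

/-- `u ∈ W^{1,p}_F(Ω)`: `u` lies in `W^{1,p}_loc(Ω)`, has finite norm, and is in the closure of
`C^∞(Ω)` for the asymmetric norm (in both orders of the difference). -/
structure MemSobolev {d : ℕ} (Ω : Set (E d)) (g : E d → Matrix (Fin d) (Fin d) ℝ)
    (β : E d → Fin d → ℝ) (p : ℝ) (u : E d → ℝ) : Prop where
  memLoc : MemSobolevLoc Ω p u
  norm_lt_top : sobolevNorm Ω g β p u < ⊤
  mem_closure : ∀ ε : ℝ≥0∞, 0 < ε → ∃ φ : E d → ℝ, ContDiffOn ℝ ∞ φ Ω ∧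
    sobolevNorm Ω g β p (fun x => u x - φ x) < ε ∧ sobolevNorm Ω g β p (fun x => φ x - u x) < ε

/-- The continuous embedding `W^{1,p}_F(Ω) ↪ L^q(Ω)`: there is a finite `C` such that
`‖u‖_{L^q} ≤ C ‖u‖_{W^{1,p}_F}` for every `u ∈ W^{1,p}_F(Ω)`; in particular every such `u` has finite
`L^q` norm. -/
def ContinuouslyEmbeds {d : ℕ} (Ω : Set (E d)) (g : E d → Matrix (Fin d) (Fin d) ℝ)
    (β : E d → Fin d → ℝ) (p : ℝ) (q : ℝ≥0∞) : Prop :=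
  ∃ C : ℝ≥0, ∀ u : E d → ℝ, MemSobolev Ω g β p u →
    eLpNorm u q (randersVolume Ω g β) ≤ C * sobolevNorm Ω g β p u

/-- `(p, q) ∈ (1, ∞) × (1, ∞]` is a `d`-admissible pair. -/
def IsAdmissible (d : ℕ) (p : ℝ) (q : ℝ≥0∞) : Prop :=
  1 < p ∧
    ((p < d ∧ ENNReal.ofReal p < q ∧ q < ENNReal.ofReal (p * d / (d - p))) ∨
     (p = d ∧ ENNReal.ofReal p < q ∧ q < ⊤) ∨
     ((d : ℝ) < p ∧ q = ⊤))

/-! ### The Funk model -/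

/-- The Funk metric on the unit ball. -/
def funkMetric {d : ℕ} (x y : E d) : ℝ :=
  Real.sqrt (‖y‖ ^ 2 - (‖x‖ ^ 2 * ‖y‖ ^ 2 - inner ℝ x y ^ 2)) / (1 - ‖x‖ ^ 2)
    + inner ℝ x y / (1 - ‖x‖ ^ 2)

/-- The Riemannian part of the Funk metric (the Klein metric). -/
def kleinMetric {d : ℕ} (x : E d) : Matrix (Fin d) (Fin d) ℝ :=
  Matrix.of fun i j => (if i = j then 1 else 0) / (1 - ‖x‖ ^ 2) + x i * x j / (1 - ‖x‖ ^ 2) ^ 2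

/-- The one-form part of the Funk metric. -/
def funkForm {d : ℕ} (x : E d) : Fin d → ℝ := fun i => x i / (1 - ‖x‖ ^ 2)

/-- The function `|x| (1 - |x|)^(-1/t)`. -/
def funkFunction {d : ℕ} (t : ℝ) (x : E d) : ℝ := ‖x‖ * (1 - ‖x‖) ^ (-(1 / t))

end FunkModel

end

/-!
The Klein metric is projectively flat: its Christoffel symbols have the form `δ ⊗ ψ + ψ ⊗ δ` with
`ψ = x / (1 - |x|²)`, from which its curvature is constantly `-1`. The function `log (1 - |x|²)` is
Lipschitz for its distance and tends to `-∞` at the unit sphere, which gives completeness.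

For `y ≠ 0` the point `x + y / F(x, y)` lies on the unit sphere, so that `F*(x, α) ≤ |α| - α(x)`.
For a radial increasing function the right side is `1 - |x|` times the radial derivative: growth
towards the boundary is cheap for the Funk metric. As `dV_F` is Lebesgue measure, the Sobolev norm
of `u = |x| (1 - |x|) ^ (-1/t)` is controlled by `∫ (1 - |x|) ^ (-p/t) < ∞` for `p < t`, while
`u ^ t ~ (1 - |x|) ^ (-1)` is not integrable. The singularity of `u` at the origin is removed by a
cutoff on a ball of radius `r → 0` that keeps the Lipschitz constant bounded, so that the error in
the norm is at most a constant times a power of the volume of the ball.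
-/

namespace FunkModel

variable {d : ℕ}

section Metric

variable {g : E d → Matrix (Fin d) (Fin d) ℝ} {x : E d}

lemma metricForm_eq_dotProduct (y z : E d) : metricForm g x y z = y.ofLp ⬝ᵥ g x *ᵥ z.ofLp := by
  simp only [metricForm, dotProduct, Matrix.mulVec, Finset.mul_sum]
  exact Finset.sum_congr rfl fun i _ => Finset.sum_congr rfl fun j _ => by ring

lemma coMetric_eq_dotProduct (α α' : Fin d → ℝ) : coMetric g x α α' = α ⬝ᵥ (g x)⁻¹ *ᵥ α' := by
  simp only [coMetric, dotProduct, Matrix.mulVec, Finset.mul_sum]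
  exact Finset.sum_congr rfl fun i _ => Finset.sum_congr rfl fun j _ => by ring

lemma coMetric_mulVec (h : IsUnit (g x).det) (y z : E d) :
    coMetric g x (g x *ᵥ y.ofLp) (g x *ᵥ z.ofLp) = metricForm g x z y := by
  rw [coMetric_eq_dotProduct, Matrix.mulVec_mulVec, Matrix.nonsing_inv_mul _ h, Matrix.one_mulVec,
    metricForm_eq_dotProduct, dotProduct_comm]

lemma metricForm_mul_metricForm_le (h : (g x).PosSemidef) (y z : E d) :
    metricForm g x y z * metricForm g x z y ≤ metricForm g x y y * metricForm g x z z := by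
  simp only [metricForm_eq_dotProduct, ← Matrix.toBilin'_apply']
  refine LinearMap.BilinForm.apply_mul_apply_le_of_forall_zero_le _ (fun v => ?_) _ _
  rw [Matrix.toBilin'_apply']
  exact h.dotProduct_mulVec_nonneg v

end Metric

section Curvature

lemma pderiv_mul {f h : E d → ℝ} {x : E d} (i : Fin d) (hf : DifferentiableAt ℝ f x)
    (hh : DifferentiableAt ℝ h x) :
    pderiv i (fun z => f z * h z) x = pderiv i f x * h x + f x * pderiv i h x := by
  rw [pderiv, fderiv_fun_mul hf hh]
  simp only [_root_.add_apply, _root_.smul_apply, smul_eq_mul, pderiv]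
  ring

lemma pderiv_add {f h : E d → ℝ} {x : E d} (i : Fin d) (hf : DifferentiableAt ℝ f x)
    (hh : DifferentiableAt ℝ h x) :
    pderiv i (fun z => f z + h z) x = pderiv i f x + pderiv i h x := by
  rw [pderiv, fderiv_fun_add hf hh, _root_.add_apply]; rfl

lemma pderiv_const_mul {f : E d → ℝ} {x : E d} (i : Fin d) (c : ℝ) (hf : DifferentiableAt ℝ f x) :
    pderiv i (fun z => c * f z) x = c * pderiv i f x := by
  rw [pderiv, fderiv_const_mul hf, _root_.smul_apply, smul_eq_mul, pderiv]

variable {g : E d → Matrix (Fin d) (Fin d) ℝ} {x : E d}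

lemma christoffel_eq_of_lowered_eq (h : IsUnit (g x).det) {i j : Fin d} {Γ : Fin d → ℝ}
    (hΓ : ∀ l, pderiv i (fun z => g z j l) x + pderiv j (fun z => g z i l) x
      - pderiv l (fun z => g z i j) x = 2 * (g x *ᵥ Γ) l) (k : Fin d) :
    christoffel g k i j x = Γ k := by
  have raise : ((g x)⁻¹ *ᵥ g x *ᵥ Γ) k = Γ k := by
    rw [Matrix.mulVec_mulVec, Matrix.nonsing_inv_mul _ h, Matrix.one_mulVec]
  rw [← raise, christoffel, Matrix.mulVec, dotProduct, Finset.mul_sum]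
  exact Finset.sum_congr rfl fun l _ => by rw [hΓ]; ring

/-- The connection `Γ^k_{ij} = δ^k_i ψ_j + δ^k_j ψ_i`, whose geodesics are straight lines. -/
def projectivelyFlatConnection (ψ : E d → Fin d → ℝ) (k i j : Fin d) (x : E d) : ℝ :=
  (if k = i then 1 else 0) * ψ x j + (if k = j then 1 else 0) * ψ x i

lemma christoffel_eq_projectivelyFlatConnection {ψ : E d → Fin d → ℝ} (hdet : IsUnit (g x).det)
    (hsymm : (g x).IsSymm)
    (hg : ∀ i j l, pderiv i (fun z => g z j l) x =
      2 * ψ x i * g x j l + ψ x j * g x i l + ψ x l * g x i j) (k i j : Fin d) :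
    christoffel g k i j x = projectivelyFlatConnection ψ k i j x := by
  refine christoffel_eq_of_lowered_eq (Γ := fun k => projectivelyFlatConnection ψ k i j x)
    hdet (fun l => ?_) k
  have hlower : (g x *ᵥ fun k => projectivelyFlatConnection ψ k i j x) l =
      g x l i * ψ x j + g x l j * ψ x i := by
    simp [Matrix.mulVec, dotProduct, projectivelyFlatConnection, mul_add, Finset.sum_add_distrib]
  rw [hlower, hg, hg, hg, hsymm.apply j l, hsymm.apply i l, hsymm.apply i j]
  ring

lemma pderiv_projectivelyFlatConnection {ψ : E d → Fin d → ℝ}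
    (hψ : ∀ i, DifferentiableAt ℝ (fun z => ψ z i) x) (m k i j : Fin d) :
    pderiv m (projectivelyFlatConnection ψ k i j) x =
      (if k = i then 1 else 0) * pderiv m (fun z => ψ z j) x +
        (if k = j then 1 else 0) * pderiv m (fun z => ψ z i) x := by
  have := pderiv_add m ((hψ j).const_mul (if k = i then 1 else 0))
    ((hψ i).const_mul (if k = j then 1 else 0))
  rwa [pderiv_const_mul m _ (hψ j), pderiv_const_mul m _ (hψ i)] at this

lemma riemannTensor_of_projectivelyFlat {ψ : E d → Fin d → ℝ}
    (hψ : ∀ i, DifferentiableAt ℝ (fun z => ψ z i) x)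
    (hΓ : ∀ k i j, christoffel g k i j =ᶠ[𝓝 x] projectivelyFlatConnection ψ k i j)
    (l k i j : Fin d) :
    riemannTensor g l k i j x =
      (if l = j then 1 else 0) * (pderiv i (fun z => ψ z k) x - ψ x i * ψ x k)
        - (if l = i then 1 else 0) * (pderiv j (fun z => ψ z k) x - ψ x j * ψ x k)
        + (if l = k then 1 else 0) *
          (pderiv i (fun z => ψ z j) x - pderiv j (fun z => ψ z i) x) := by
  have hderiv : ∀ m k i j, pderiv m (christoffel g k i j) x =
      pderiv m (projectivelyFlatConnection ψ k i j) x := fun m k i j => by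
    rw [pderiv, (hΓ k i j).fderiv_eq, pderiv]
  have hquad : ∀ i j, ∑ m, projectivelyFlatConnection ψ l i m x *
      projectivelyFlatConnection ψ m j k x = (if l = i then 1 else 0) * (2 * ψ x j * ψ x k) +
        ψ x i * projectivelyFlatConnection ψ l j k x := fun i j => by
    simp only [projectivelyFlatConnection, add_mul, mul_add, Finset.sum_add_distrib, mul_assoc,
      ite_mul, one_mul, zero_mul, mul_ite, mul_zero, Finset.sum_ite_eq',
      Finset.mem_univ, if_true]
    split_ifs <;> ring
  simp only [riemannTensor, hderiv, (hΓ _ _ _).eq_of_nhds, Finset.sum_sub_distrib, hquad,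
    pderiv_projectivelyFlatConnection hψ]
  simp only [projectivelyFlatConnection]
  ring

lemma sectionalForm_of_constant_curvature {K : ℝ}
    (hR : ∀ l k i j, riemannTensor g l k i j x =
      K * ((if l = i then 1 else 0) * g x j k - (if l = j then 1 else 0) * g x i k)) (X Y : E d) :
    sectionalForm g x X Y =
      K * (metricForm g x X X * metricForm g x Y Y - metricForm g x X Y * metricForm g x Y X) := by
  have lower : ∀ i j k s, ∑ l, g x l s * riemannTensor g l k i j x =
      K * (g x i s * g x j k - g x j s * g x i k) := fun i j k s => by
    simp only [hR, mul_sub, mul_left_comm _ K, Finset.sum_sub_distrib, ite_mul,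
      one_mul, zero_mul, mul_ite, mul_zero, Finset.sum_ite_eq', Finset.mem_univ, if_true]
  have contract : ∀ i j k, ∑ l, ∑ s, g x l s * riemannTensor g l k i j x * X i * Y j * Y k * X s =
      K * ((∑ s, g x i s * X i * X s) * (g x j k * Y j * Y k)
        - (∑ s, g x j s * Y j * X s) * (g x i k * X i * Y k)) := fun i j k => by
    rw [Finset.sum_comm, Finset.sum_mul, Finset.sum_mul, ← Finset.sum_sub_distrib, Finset.mul_sum]
    refine Finset.sum_congr rfl fun s _ => ?_
    simp only [← Finset.sum_mul, lower]
    ring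
  simp only [sectionalForm, contract, metricForm, ← Finset.mul_sum, Finset.sum_sub_distrib,
    ← Finset.sum_mul]
  ring

end Curvature

section Klein

variable {x : E d}

lemma mem_unitBall : x ∈ unitBall d ↔ ‖x‖ < 1 := by
  rw [unitBall, mem_ball_zero_iff]

lemma isOpen_unitBall : IsOpen (unitBall d) := Metric.isOpen_ball

lemma one_sub_norm_sq_pos (hx : x ∈ unitBall d) : 0 < 1 - ‖x‖ ^ 2 := by
  have := mem_unitBall.1 hx
  nlinarith [norm_nonneg x]

lemma funkForm_dotProduct (x y : E d) : funkForm x ⬝ᵥ y.ofLp = inner ℝ x y / (1 - ‖x‖ ^ 2) := by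
  simp only [funkForm, dotProduct, PiLp.inner_apply, RCLike.inner_apply, conj_trivial,
    Finset.sum_div]
  exact Finset.sum_congr rfl fun i _ => by ring

lemma kleinMetric_eq (x : E d) :
    kleinMetric x = (1 - ‖x‖ ^ 2)⁻¹ • (1 : Matrix (Fin d) (Fin d) ℝ) +
      Matrix.vecMulVec (funkForm x) (funkForm x) := by
  ext i j
  simp only [kleinMetric, funkForm, Matrix.of_apply, Matrix.add_apply, Matrix.smul_apply,
    Matrix.one_apply, Matrix.vecMulVec_apply, smul_eq_mul, div_mul_div_comm, ← sq]
  ring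

lemma kleinMetric_apply (x : E d) (i j : Fin d) :
    kleinMetric x i j =
      (if i = j then 1 else 0) * (1 - ‖x‖ ^ 2)⁻¹ + funkForm x i * funkForm x j := by
  rw [kleinMetric_eq, Matrix.add_apply, Matrix.smul_apply, Matrix.one_apply,
    Matrix.vecMulVec_apply, smul_eq_mul, mul_comm]

lemma kleinMetric_mulVec (x y : E d) :
    kleinMetric x *ᵥ y.ofLp =
      (1 - ‖x‖ ^ 2)⁻¹ • y.ofLp + (inner ℝ x y / (1 - ‖x‖ ^ 2)) • funkForm x := by
  rw [kleinMetric_eq, Matrix.add_mulVec, Matrix.smul_mulVec, Matrix.one_mulVec,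
    Matrix.vecMulVec_mulVec, funkForm_dotProduct, op_smul_eq_smul]

lemma metricForm_kleinMetric_self (x y : E d) :
    metricForm kleinMetric x y y =
      ‖y‖ ^ 2 / (1 - ‖x‖ ^ 2) + (inner ℝ x y / (1 - ‖x‖ ^ 2)) ^ 2 := by
  have hy : y.ofLp ⬝ᵥ y.ofLp = ‖y‖ ^ 2 := by
    rw [EuclideanSpace.real_norm_sq_eq]
    exact Finset.sum_congr rfl fun i _ => (sq (y i)).symm
  rw [metricForm_eq_dotProduct, kleinMetric_mulVec, dotProduct_add, dotProduct_smul,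
    dotProduct_smul, dotProduct_comm _ (funkForm x), funkForm_dotProduct, hy, smul_eq_mul,
    smul_eq_mul]
  ring

lemma isSymm_kleinMetric (x : E d) : (kleinMetric x).IsSymm :=
  Matrix.IsSymm.ext fun i j => by rw [kleinMetric_apply, kleinMetric_apply, mul_comm (funkForm x j),
    if_congr eq_comm rfl rfl]

lemma posDef_kleinMetric (hx : x ∈ unitBall d) : (kleinMetric x).PosDef := by
  rw [kleinMetric_eq]
  exact (Matrix.PosDef.one.smul (inv_pos.2 (one_sub_norm_sq_pos hx))).add_posSemidef
    (Matrix.posSemidef_vecMulVec_self_star (funkForm x))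

lemma isUnit_det_kleinMetric (hx : x ∈ unitBall d) : IsUnit (kleinMetric x).det :=
  (posDef_kleinMetric hx).det_pos.ne'.isUnit

lemma contDiff_coord (i : Fin d) : ContDiff ℝ ∞ (fun x : E d => x i) :=
  (EuclideanSpace.proj i : E d →L[ℝ] ℝ).contDiff

lemma contDiffOn_inv_one_sub_norm_sq :
    ContDiffOn ℝ ∞ (fun x : E d => (1 - ‖x‖ ^ 2)⁻¹) (unitBall d) :=
  (contDiff_const.sub (contDiff_norm_sq ℝ)).contDiffOn.inv fun _ hx => (one_sub_norm_sq_pos hx).ne'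

lemma contDiffOn_funkForm (i : Fin d) : ContDiffOn ℝ ∞ (fun x => funkForm x i) (unitBall d) :=
  (contDiff_coord i).contDiffOn.mul contDiffOn_inv_one_sub_norm_sq

lemma isRiemannianMetric_kleinMetric : IsRiemannianMetric (unitBall d) kleinMetric where
  isOpen := isOpen_unitBall
  smooth i j := by
    simp only [kleinMetric_apply]
    exact (contDiffOn_const.mul contDiffOn_inv_one_sub_norm_sq).add
      ((contDiffOn_funkForm i).mul (contDiffOn_funkForm j))
  posDef _ := posDef_kleinMetric

lemma det_kleinMetric (hx : x ∈ unitBall d) :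
    (kleinMetric x).det = ((1 - ‖x‖ ^ 2) ^ (d + 1))⁻¹ := by
  have hw := (one_sub_norm_sq_pos hx).ne'
  have factor : kleinMetric x = (1 - ‖x‖ ^ 2)⁻¹ • (1 + Matrix.replicateCol Unit x.ofLp *
      Matrix.replicateRow Unit (funkForm x)) := by
    rw [kleinMetric_eq, smul_add, ← Matrix.vecMulVec_eq, ← Matrix.smul_vecMulVec]
    congr 2
    ext i
    rw [funkForm, Pi.smul_apply, smul_eq_mul, div_eq_inv_mul]
  rw [factor, Matrix.det_smul, Matrix.det_one_add_replicateCol_mul_replicateRow,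
    funkForm_dotProduct, real_inner_self_eq_norm_sq, Fintype.card_fin, inv_pow]
  field_simp
  rw [sub_add_cancel, one_mul, pow_succ, mul_comm]

/-- `g_x((1 - |x|²) x, ·) = β_x`, so that `‖β‖_g(x)` is the length of this vector. -/
lemma kleinMetric_mulVec_smul_self (hx : x ∈ unitBall d) :
    kleinMetric x *ᵥ ((1 - ‖x‖ ^ 2) • x).ofLp = funkForm x := by
  have hw := (one_sub_norm_sq_pos hx).ne'
  rw [kleinMetric_mulVec, real_inner_smul_right, real_inner_self_eq_norm_sq]
  ext i
  simp only [funkForm, Pi.add_apply, Pi.smul_apply, PiLp.smul_apply, smul_eq_mul]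
  field_simp
  ring

lemma formNorm_kleinMetric_funkForm (hx : x ∈ unitBall d) :
    formNorm kleinMetric funkForm x = ‖x‖ := by
  have hw := one_sub_norm_sq_pos hx
  rw [formNorm, ← kleinMetric_mulVec_smul_self hx, coMetric_mulVec (isUnit_det_kleinMetric hx),
    metricForm_kleinMetric_self, real_inner_smul_right, real_inner_self_eq_norm_sq, norm_smul,
    Real.norm_of_nonneg hw.le, Real.sqrt_eq_iff_mul_self_eq (by positivity) (norm_nonneg x)]
  field_simp
  ring

lemma isRandersSpace_kleinMetric_funkForm :
    IsRandersSpace (unitBall d) kleinMetric funkForm where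
  metric := isRiemannianMetric_kleinMetric
  smooth := contDiffOn_funkForm
  formNorm_lt_one x hx := by
    rw [formNorm_kleinMetric_funkForm hx]
    exact mem_unitBall.1 hx

lemma funkMetric_eq_randersMetric (hx : x ∈ unitBall d) (y : E d) :
    funkMetric x y = randersMetric kleinMetric funkForm x y := by
  have hw := one_sub_norm_sq_pos hx
  rw [funkMetric, randersMetric, metricForm_kleinMetric_self, ← dotProduct, funkForm_dotProduct]
  congr 1
  rw [← Real.sqrt_sq hw.le, ← Real.sqrt_div' _ (sq_nonneg _), Real.sqrt_sq hw.le]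
  congr 1
  field_simp
  ring

lemma randersVolume_kleinMetric_funkForm :
    randersVolume (unitBall d) kleinMetric funkForm = volume.restrict (unitBall d) := by
  rw [randersVolume]
  conv_rhs => rw [← withDensity_one (μ := volume.restrict (unitBall d))]
  refine withDensity_congr_ae ?_
  filter_upwards [ae_restrict_mem isOpen_unitBall.measurableSet] with x hx
  have hw := one_sub_norm_sq_pos hx
  have hexp : ((d + 1 : ℕ) : ℝ) * (1 / 2) = ((d : ℝ) + 1) / 2 := by push_cast; ring
  rw [formNorm_kleinMetric_funkForm hx, det_kleinMetric hx, Real.sqrt_eq_rpow,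
    Real.inv_rpow (by positivity), ← Real.rpow_natCast (1 - ‖x‖ ^ 2) (d + 1), ← Real.rpow_mul hw.le,
    hexp, mul_inv_cancel₀ (by positivity), ENNReal.ofReal_one, Pi.one_apply]

lemma isLUB_formNorm_image [NeZero d] :
    IsLUB (formNorm kleinMetric funkForm '' unitBall d) 1 := by
  have image_eq : formNorm kleinMetric funkForm '' unitBall d = Ico 0 1 := by
    refine Subset.antisymm ?_ fun r hr => ?_
    · rintro _ ⟨x, hx, rfl⟩
      rw [formNorm_kleinMetric_funkForm hx]
      exact ⟨norm_nonneg x, mem_unitBall.1 hx⟩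
    · obtain ⟨x, rfl⟩ := exists_norm_eq (E d) hr.1
      exact ⟨x, mem_unitBall.2 hr.2, formNorm_kleinMetric_funkForm (mem_unitBall.2 hr.2)⟩
  rw [image_eq]
  exact isLUB_Ico one_pos

lemma funkMetric_smul_unit {e : E d} (he : ‖e‖ = 1) {r : ℝ} (hr : r ≠ -1) :
    funkMetric (r • e) e = (1 - r)⁻¹ := by
  have h : 1 + r ≠ 0 := fun h => hr (by linarith)
  rw [funkMetric, norm_smul, real_inner_smul_left, real_inner_self_eq_norm_sq, he, ← add_div,
    Real.norm_eq_abs, mul_one, sq_abs, show 1 - r ^ 2 = (1 + r) * (1 - r) by ring,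
    show (1 : ℝ) ^ 2 - (r ^ 2 * 1 ^ 2 - (r * 1 ^ 2) ^ 2) = 1 by ring, Real.sqrt_one, one_pow,
    mul_one, div_mul_cancel_left₀ h]

lemma reversibility_funkMetric [NeZero d] :
    reversibility (unitBall d) (funkMetric (d := d)) = ⊤ := by
  obtain ⟨e, he⟩ := exists_norm_eq (E d) zero_le_one
  refine ENNReal.eq_top_of_forall_nnreal_le fun K => ?_
  set r : ℝ := K / (K + 1)
  have hr : 0 ≤ r := by positivity
  have hr1 : r < 1 := (div_lt_one (by positivity)).2 (lt_add_one _)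
  have hre : r • e ∈ unitBall d := by
    rwa [mem_unitBall, norm_smul, he, mul_one, Real.norm_of_nonneg hr]
  have backward : funkMetric (r • e) (-e) = (1 + r)⁻¹ := by
    rw [← neg_smul_neg, funkMetric_smul_unit (by rwa [norm_neg]) (neg_inj.not.2 hr1.ne),
      sub_neg_eq_add]
  refine le_trans ?_ (le_iSup₂_of_le (r • e) hre
    (le_iSup₂_of_le e (norm_ne_zero_iff.1 (he ▸ one_ne_zero)) le_rfl))
  rw [funkMetric_smul_unit he (by linarith), backward, ← ENNReal.ofReal_coe_nnreal,
    show (1 - r)⁻¹ / (1 + r)⁻¹ = 2 * K + 1 by simp only [r]; field_simp; ring]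
  exact ENNReal.ofReal_le_ofReal (by linarith [K.coe_nonneg])

end Klein

section KleinCurvature

variable {x : E d}

lemma differentiableAt_coord (i : Fin d) : DifferentiableAt ℝ (fun z : E d => z i) x :=
  (contDiff_coord i).contDiffAt.differentiableAt (by simp)

lemma pderiv_coord (i j : Fin d) : pderiv i (fun z : E d => z j) x = if i = j then 1 else 0 := by
  have h : fderiv ℝ (fun z : E d => z j) x = EuclideanSpace.proj j :=
    (EuclideanSpace.proj j : E d →L[ℝ] ℝ).fderiv
  rw [pderiv, h, PiLp.proj_apply, PiLp.single_apply]
  exact if_congr eq_comm rfl rfl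

lemma differentiableAt_inv_one_sub_norm_sq (hx : x ∈ unitBall d) :
    DifferentiableAt ℝ (fun z : E d => (1 - ‖z‖ ^ 2)⁻¹) x :=
  (contDiffOn_inv_one_sub_norm_sq.contDiffAt (isOpen_unitBall.mem_nhds hx)).differentiableAt
    (by simp)

lemma pderiv_inv_one_sub_norm_sq (hx : x ∈ unitBall d) (i : Fin d) :
    pderiv i (fun z : E d => (1 - ‖z‖ ^ 2)⁻¹) x = 2 * funkForm x i * (1 - ‖x‖ ^ 2)⁻¹ := by
  have hN : HasFDerivAt (fun z : E d => 1 - ‖z‖ ^ 2) (-(2 • innerSL ℝ x)) x :=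
    (hasStrictFDerivAt_norm_sq x).hasFDerivAt.const_sub 1
  have hinv : HasFDerivAt (fun z : E d => (1 - ‖z‖ ^ 2)⁻¹) _ x :=
    (hasDerivAt_inv (one_sub_norm_sq_pos hx).ne').comp_hasFDerivAt x hN
  rw [pderiv, hinv.fderiv]
  simp only [_root_.smul_apply, _root_.neg_apply, innerSL_apply_apply,
    EuclideanSpace.inner_single_right, conj_trivial, funkForm, smul_eq_mul, nsmul_eq_mul, ← inv_pow]
  push_cast
  ring

lemma differentiableAt_funkForm (hx : x ∈ unitBall d) (i : Fin d) :
    DifferentiableAt ℝ (fun z => funkForm z i) x :=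
  ((contDiffOn_funkForm i).contDiffAt (isOpen_unitBall.mem_nhds hx)).differentiableAt (by simp)

lemma pderiv_funkForm (hx : x ∈ unitBall d) (i j : Fin d) :
    pderiv i (fun z => funkForm z j) x = kleinMetric x i j + funkForm x i * funkForm x j := by
  simp only [funkForm, div_eq_mul_inv]
  rw [pderiv_mul i (differentiableAt_coord j) (differentiableAt_inv_one_sub_norm_sq hx),
    pderiv_coord, pderiv_inv_one_sub_norm_sq hx, kleinMetric_apply]
  simp only [funkForm]
  ring

lemma pderiv_kleinMetric (hx : x ∈ unitBall d) (i j l : Fin d) :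
    pderiv i (fun z => kleinMetric z j l) x = 2 * funkForm x i * kleinMetric x j l +
      funkForm x j * kleinMetric x i l + funkForm x l * kleinMetric x i j := by
  have hw := differentiableAt_inv_one_sub_norm_sq hx
  have hψ := differentiableAt_funkForm hx
  simp only [kleinMetric_apply _ j l]
  rw [pderiv_add i (hw.const_mul _) ((hψ j).fun_mul (hψ l)), pderiv_const_mul i _ hw,
    pderiv_mul i (hψ j) (hψ l), pderiv_inv_one_sub_norm_sq hx, pderiv_funkForm hx,
    pderiv_funkForm hx]
  ring

lemma christoffel_kleinMetric (hx : x ∈ unitBall d) (k i j : Fin d) :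
    christoffel kleinMetric k i j x = projectivelyFlatConnection funkForm k i j x :=
  christoffel_eq_projectivelyFlatConnection (isUnit_det_kleinMetric hx) (isSymm_kleinMetric x)
    (pderiv_kleinMetric hx) k i j

lemma riemannTensor_kleinMetric (hx : x ∈ unitBall d) (l k i j : Fin d) :
    riemannTensor kleinMetric l k i j x =
      -1 * ((if l = i then 1 else 0) * kleinMetric x j k
        - (if l = j then 1 else 0) * kleinMetric x i k) := by
  rw [riemannTensor_of_projectivelyFlat (differentiableAt_funkForm hx) fun k i j =>
    (isOpen_unitBall.eventually_mem hx).mono fun z hz => christoffel_kleinMetric hz k i j]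
  simp only [pderiv_funkForm hx]
  rw [(isSymm_kleinMetric x).apply j i]
  ring

lemma sectionalForm_kleinMetric_nonpos (hx : x ∈ unitBall d) (X Y : E d) :
    sectionalForm kleinMetric x X Y ≤ 0 := by
  rw [sectionalForm_of_constant_curvature (riemannTensor_kleinMetric hx)]
  linarith [metricForm_mul_metricForm_le (posDef_kleinMetric hx).posSemidef X Y]

end KleinCurvature

section InducedDistance

variable {Ω : Set (E d)} {F : E d → E d → ℝ} {x y : E d}

lemma IsPiecewiseSmoothCurve.exists_differentiableAt {γ : ℝ → E d}
    (hγ : IsPiecewiseSmoothCurve Ω x y γ) :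
    ∃ S : Finset ℝ, ∀ t ∈ Ioo (0 : ℝ) 1 \ S, DifferentiableAt ℝ γ t := by
  obtain ⟨S, hS⟩ := hγ.piecewise
  refine ⟨S, fun t ht => ?_⟩
  have hnhds : Ioo (0 : ℝ) 1 \ S ∈ 𝓝 t := (isOpen_Ioo.sdiff S.finite_toSet.isClosed).mem_nhds ht
  obtain ⟨ε, hε, hball⟩ := Metric.nhds_basis_closedBall.mem_iff.1 hnhds
  rw [Real.closedBall_eq_Icc] at hball
  have hab : t - ε < t + ε := by linarith
  have hleft := hball (left_mem_Icc.2 hab.le)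
  have hright := hball (right_mem_Icc.2 hab.le)
  have hsmooth := hS _ _ hleft.1.1.le hab hright.1.2.le fun s hs hs' =>
    (hball (Ioo_subset_Icc_self hs')).2 hs
  exact (hsmooth.differentiableOn (by simp)).differentiableAt
    (Icc_mem_nhds (by linarith) (by linarith))

section LowerBound

variable {G : Type*} [NormedAddCommGroup G] [NormedSpace ℝ G] [CompleteSpace G]
  [SecondCountableTopology G] {f : E d → G}

lemma enorm_sub_le_curveLength (hΩ : IsOpen Ω) (hf : DifferentiableOn ℝ f Ω)
    (hF : ∀ z ∈ Ω, ∀ v, ‖fderiv ℝ f z v‖ ≤ F z v) {γ : ℝ → E d}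
    (hγ : IsPiecewiseSmoothCurve Ω x y γ) : ‖f y - f x‖ₑ ≤ curveLength F γ := by
  rcases eq_or_ne (curveLength F γ) ⊤ with htop | htop
  · exact htop ▸ le_top
  obtain ⟨S, hS⟩ := hγ.exists_differentiableAt
  have mem_of_Ioo : ∀ t ∈ Ioo (0 : ℝ) 1, γ t ∈ Ω := fun t ht =>
    hγ.mapsTo (Ioo_subset_Icc_self ht)
  have chain : ∀ t ∈ Ioo (0 : ℝ) 1 \ S,
      HasDerivAt (f ∘ γ) (fderiv ℝ f (γ t) (deriv γ t)) t := fun t ht =>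
    ((hf.differentiableAt (hΩ.mem_nhds (mem_of_Ioo t ht.1))).hasFDerivAt).comp_hasDerivAt t
      (hS t ht).hasDerivAt
  have speed_le : ∫⁻ t in Ioc (0 : ℝ) 1, ‖deriv (f ∘ γ) t‖ₑ ≤ curveLength F γ := by
    rw [← restrict_Ioo_eq_restrict_Ioc, curveLength, ← restrict_Ioo_eq_restrict_Icc]
    refine lintegral_mono_ae ?_
    filter_upwards [ae_restrict_of_ae (S.countable_toSet.ae_notMem volume),
      ae_restrict_mem measurableSet_Ioo] with t htS ht
    rw [(chain t ⟨ht, htS⟩).deriv, ← ofReal_norm]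
    exact ENNReal.ofReal_le_ofReal (hF _ (mem_of_Ioo t ht) _)
  have integrable : IntervalIntegrable (deriv (f ∘ γ)) volume 0 1 := by
    rw [intervalIntegrable_iff_integrableOn_Ioc_of_le zero_le_one]
    exact ⟨(stronglyMeasurable_deriv _).aestronglyMeasurable, speed_le.trans_lt htop.lt_top⟩
  have ftc := integral_eq_of_hasDerivAt_off_countable_of_le (f ∘ γ) (deriv (f ∘ γ)) zero_le_one
    S.countable_toSet (hf.continuousOn.comp hγ.continuousOn hγ.mapsTo)
    (fun t ht => (chain t ht).differentiableAt.hasDerivAt) integrable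
  simp only [Function.comp_apply, hγ.source, hγ.target] at ftc
  rw [← ftc, intervalIntegral.integral_of_le zero_le_one]
  exact (enorm_integral_le_lintegral_enorm _).trans speed_le

lemma enorm_sub_le_inducedDist (hΩ : IsOpen Ω) (hf : DifferentiableOn ℝ f Ω)
    (hF : ∀ z ∈ Ω, ∀ v, ‖fderiv ℝ f z v‖ ≤ F z v) (x y : E d) :
    ‖f y - f x‖ₑ ≤ inducedDist Ω F x y :=
  le_iInf₂ fun _ => enorm_sub_le_curveLength hΩ hf hF

end LowerBound

lemma isPiecewiseSmoothCurve_lineMap (h : segment ℝ x y ⊆ Ω) :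
    IsPiecewiseSmoothCurve Ω x y (AffineMap.lineMap x y) where
  mapsTo _ ht := h (segment_eq_image_lineMap ℝ x y ▸ mem_image_of_mem _ ht)
  source := AffineMap.lineMap_apply_zero x y
  target := AffineMap.lineMap_apply_one x y
  continuousOn := AffineMap.lineMap_continuous.continuousOn
  piecewise := ⟨∅, fun _ _ _ _ _ _ => (AffineMap.contDiff_lineMap x y).contDiffOn⟩

lemma inducedDist_le_of_segment {C : ℝ} (h : segment ℝ x y ⊆ Ω)
    (hF : ∀ z ∈ segment ℝ x y, ∀ v, F z v ≤ C * ‖v‖) :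
    inducedDist Ω F x y ≤ ENNReal.ofReal (C * ‖y - x‖) := by
  refine (iInf₂_le _ (isPiecewiseSmoothCurve_lineMap h)).trans ?_
  calc curveLength F (AffineMap.lineMap x y)
      ≤ ∫⁻ _ in Icc (0 : ℝ) 1, ENNReal.ofReal (C * ‖y - x‖) := by
        refine setLIntegral_mono measurable_const fun t ht => ENNReal.ofReal_le_ofReal ?_
        rw [AffineMap.hasDerivAt_lineMap.deriv]
        exact hF _ (segment_eq_image_lineMap ℝ x y ▸ mem_image_of_mem _ ht) _
    _ = ENNReal.ofReal (C * ‖y - x‖) := by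
        rw [setLIntegral_const, Real.volume_Icc, sub_zero, ENNReal.ofReal_one, mul_one]

lemma tendsto_inducedDist {s : ℕ → E d} {C : ℝ} (hΩ : Ω ∈ 𝓝 x)
    (hF : ∀ᶠ z in 𝓝 x, ∀ v, F z v ≤ C * ‖v‖) (hs : Tendsto s atTop (𝓝 x)) :
    Tendsto (fun n => inducedDist Ω F (s n) x) atTop (𝓝 0) := by
  obtain ⟨ε, hε, hball⟩ := Metric.mem_nhds_iff.1 (inter_mem hΩ hF)
  have hlim : Tendsto (fun n => ENNReal.ofReal (C * ‖x - s n‖)) atTop (𝓝 0) := by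
    have := ENNReal.tendsto_ofReal ((tendsto_const_nhds (x := x).sub hs).norm.const_mul C)
    rwa [sub_self, norm_zero, mul_zero, ENNReal.ofReal_zero] at this
  refine tendsto_of_tendsto_of_tendsto_of_le_of_le' tendsto_const_nhds hlim
    (.of_forall fun _ => zero_le) ?_
  filter_upwards [hs.eventually_mem (Metric.ball_mem_nhds x hε)] with n hn
  have hseg := ((convex_ball x ε).segment_subset hn (Metric.mem_ball_self hε)).trans hball
  exact inducedDist_le_of_segment (fun z hz => (hseg hz).1) fun z hz => (hseg hz).2

/-- A differentiable exhaustion function `f` with `|df| ≤ F` keeps Cauchy sequences inside a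
compact set. -/
theorem exists_tendsto_inducedDist_of_exhaustion (hΩ : IsOpen Ω)
    (hlower : ∀ z ∈ Ω, ∀ v, ‖v‖ ≤ F z v)
    (hupper : ∀ z ∈ Ω, ∃ C : ℝ, ∀ᶠ z' in 𝓝 z, ∀ v, F z' v ≤ C * ‖v‖) {f : E d → ℝ}
    (hf : DifferentiableOn ℝ f Ω) (hfF : ∀ z ∈ Ω, ∀ v, ‖fderiv ℝ f z v‖ ≤ F z v)
    (hsublevel : ∀ c, ∃ K ⊆ Ω, IsCompact K ∧ ∀ z ∈ Ω, f z ≤ c → z ∈ K) {s : ℕ → E d}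
    (hs : ∀ n, s n ∈ Ω)
    (hcauchy : ∀ ε : ℝ≥0∞, 0 < ε → ∃ N, ∀ m ≥ N, ∀ n ≥ N, inducedDist Ω F (s m) (s n) < ε) :
    ∃ x ∈ Ω, Tendsto (fun n => inducedDist Ω F (s n) x) atTop (𝓝 0) := by
  have hcauchy' : CauchySeq s := by
    refine EMetric.cauchySeq_iff.2 fun ε hε => ?_
    obtain ⟨N, hN⟩ := hcauchy ε hε
    refine ⟨N, fun m hm n hn => ?_⟩
    rw [edist_eq_enorm_sub]
    refine (enorm_sub_le_inducedDist (f := fun z => z) hΩ differentiableOn_id (fun z hz v => ?_) _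
      _).trans_lt (hN n hn m hm)
    rw [fderiv_fun_id, ContinuousLinearMap.id_apply]
    exact hlower z hz v
  obtain ⟨N, hN⟩ := hcauchy 1 one_pos
  have hbound : ∀ n ≥ N, f (s n) ≤ f (s N) + 1 := fun n hn => by
    have h := (enorm_sub_le_inducedDist hΩ hf hfF (s N) (s n)).trans_lt (hN N le_rfl n hn)
    rw [← ofReal_norm, ENNReal.ofReal_lt_one, Real.norm_eq_abs] at h
    linarith [le_abs_self (f (s n) - f (s N))]
  obtain ⟨K, hKΩ, hK, hfK⟩ := hsublevel (f (s N) + 1)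
  obtain ⟨x, hx⟩ := cauchySeq_tendsto_of_complete hcauchy'
  have hxK : x ∈ K := hK.isClosed.mem_of_tendsto hx
    ((eventually_ge_atTop N).mono fun n hn => hfK _ (hs n) (hbound n hn))
  obtain ⟨C, hC⟩ := hupper x (hKΩ hxK)
  exact ⟨x, hKΩ hxK, tendsto_inducedDist (hΩ.mem_nhds (hKΩ hxK)) hC hx⟩

end InducedDistance

section KleinComplete

variable {x : E d}

lemma norm_le_sqrt_metricForm_kleinMetric (hx : x ∈ unitBall d) (v : E d) :
    ‖v‖ ≤ √(metricForm kleinMetric x v v) := by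
  refine Real.le_sqrt_of_sq_le ?_
  rw [metricForm_kleinMetric_self]
  exact (le_div_self (sq_nonneg _) (one_sub_norm_sq_pos hx) (by linarith [sq_nonneg ‖x‖])).trans
    (le_add_of_nonneg_right (sq_nonneg _))

lemma abs_inner_div_le_sqrt_metricForm_kleinMetric (hx : x ∈ unitBall d) (v : E d) :
    |inner ℝ x v / (1 - ‖x‖ ^ 2)| ≤ √(metricForm kleinMetric x v v) := by
  refine Real.abs_le_sqrt ?_
  rw [metricForm_kleinMetric_self]
  exact le_add_of_nonneg_left (div_nonneg (sq_nonneg _) (one_sub_norm_sq_pos hx).le)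

lemma sqrt_metricForm_kleinMetric_le (hx : x ∈ unitBall d) (v : E d) :
    √(metricForm kleinMetric x v v) ≤ (1 - ‖x‖ ^ 2)⁻¹ * ‖v‖ := by
  have hw := one_sub_norm_sq_pos hx
  refine Real.sqrt_le_iff.2 ⟨by positivity, ?_⟩
  have hinner : inner ℝ x v ^ 2 ≤ ‖x‖ ^ 2 * ‖v‖ ^ 2 := by
    rw [← mul_pow]
    exact sq_le_sq.2 ((abs_real_inner_le_norm x v).trans (le_abs_self _))
  rw [metricForm_kleinMetric_self]
  field_simp
  linarith

lemma eventually_sqrt_metricForm_kleinMetric_le (hx : x ∈ unitBall d) :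
    ∀ᶠ z in 𝓝 x, ∀ v, √(metricForm kleinMetric z v v) ≤ 2 * (1 - ‖x‖ ^ 2)⁻¹ * ‖v‖ := by
  have hw := one_sub_norm_sq_pos hx
  have hcont := (contDiffOn_inv_one_sub_norm_sq.continuousOn (s := unitBall d)).continuousAt
    (isOpen_unitBall.mem_nhds hx)
  filter_upwards [isOpen_unitBall.mem_nhds hx, hcont.eventually_le_const
    (show (1 - ‖x‖ ^ 2)⁻¹ < 2 * (1 - ‖x‖ ^ 2)⁻¹ by linarith [inv_pos.2 hw])] with z hz hle v
  exact (sqrt_metricForm_kleinMetric_le hz v).trans (by gcongr)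

lemma hasFDerivAt_log_one_sub_norm_sq (hx : x ∈ unitBall d) :
    HasFDerivAt (fun z : E d => -(Real.log (1 - ‖z‖ ^ 2) / 2))
      ((1 - ‖x‖ ^ 2)⁻¹ • innerSL ℝ x) x := by
  have hN : HasFDerivAt (fun z : E d => 1 - ‖z‖ ^ 2) (-(2 • innerSL ℝ x)) x :=
    (hasStrictFDerivAt_norm_sq x).hasFDerivAt.const_sub 1
  refine ((hN.log (one_sub_norm_sq_pos hx).ne').mul_const (2⁻¹ : ℝ)).neg.congr_fderiv ?_
  module

lemma exists_isCompact_of_log_one_sub_norm_sq_le (c : ℝ) :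
    ∃ K ⊆ unitBall d, IsCompact K ∧
      ∀ z ∈ unitBall d, -(Real.log (1 - ‖z‖ ^ 2) / 2) ≤ c → z ∈ K := by
  refine ⟨Metric.closedBall 0 √(1 - Real.exp (-(2 * c))), ?_, isCompact_closedBall _ _,
    fun z hz hle => ?_⟩
  · refine Metric.closedBall_subset_ball ((Real.sqrt_lt' one_pos).2 ?_)
    linarith [Real.exp_pos (-(2 * c))]
  · have := (Real.le_log_iff_exp_le (one_sub_norm_sq_pos hz)).1 (show -(2 * c) ≤ _ by linarith)
    exact mem_closedBall_zero_iff.2 (Real.le_sqrt_of_sq_le (by linarith))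

theorem isHadamard_kleinMetric : IsHadamard (unitBall d) kleinMetric where
  metric := isRiemannianMetric_kleinMetric
  simplyConnected := by
    have : ContractibleSpace (unitBall d) :=
      (convex_ball (0 : E d) 1).contractibleSpace ⟨0, Metric.mem_ball_self one_pos⟩
    infer_instance
  complete s hs hcauchy := by
    refine exists_tendsto_inducedDist_of_exhaustion isOpen_unitBall
      (fun _ => norm_le_sqrt_metricForm_kleinMetric)
      (fun z hz => ⟨_, eventually_sqrt_metricForm_kleinMetric_le hz⟩)
      (fun z hz => (hasFDerivAt_log_one_sub_norm_sq hz).differentiableAt.differentiableWithinAt)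
      (fun z hz v => ?_) exists_isCompact_of_log_one_sub_norm_sq_le hs hcauchy
    rw [(hasFDerivAt_log_one_sub_norm_sq hz).fderiv, _root_.smul_apply, innerSL_apply_apply,
      smul_eq_mul, inv_mul_eq_div]
    exact abs_inner_div_le_sqrt_metricForm_kleinMetric hz v
  curvature_nonpos _ := sectionalForm_kleinMetric_nonpos

end KleinComplete

section PolarTransform

variable {x : E d}

lemma randersMetric_kleinMetric_funkForm_nonneg (hx : x ∈ unitBall d) (y : E d) :
    0 ≤ randersMetric kleinMetric funkForm x y := by
  rw [randersMetric, ← dotProduct, funkForm_dotProduct]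
  linarith [(abs_le.1 (abs_inner_div_le_sqrt_metricForm_kleinMetric hx y)).1]

lemma norm_randersMetric_smul_add (hx : x ∈ unitBall d) (y : E d) :
    ‖randersMetric kleinMetric funkForm x y • x + y‖ =
      randersMetric kleinMetric funkForm x y := by
  have hw := one_sub_norm_sq_pos hx
  have hF := randersMetric_kleinMetric_funkForm_nonneg hx y
  rw [← sq_eq_sq₀ (norm_nonneg _) hF, norm_add_sq_real, norm_smul, Real.norm_of_nonneg hF,
    real_inner_smul_left, randersMetric, ← dotProduct, funkForm_dotProduct]
  set b := inner ℝ x y / (1 - ‖x‖ ^ 2) with hb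
  set s := √(metricForm kleinMetric x y y) with hs
  have hs_sq : s ^ 2 = ‖y‖ ^ 2 / (1 - ‖x‖ ^ 2) + b ^ 2 := by
    rw [hs, Real.sq_sqrt (by rw [metricForm_kleinMetric_self]; positivity),
      metricForm_kleinMetric_self]
  have hy : ‖y‖ ^ 2 = (s ^ 2 - b ^ 2) * (1 - ‖x‖ ^ 2) := by rw [hs_sq]; field_simp; ring
  have hxy : inner ℝ x y = b * (1 - ‖x‖ ^ 2) := by rw [hb]; field_simp
  rw [hy, hxy]
  ring

lemma polarTransform_kleinMetric_funkForm_le (hx : x ∈ unitBall d) (ℓ : E d →L[ℝ] ℝ) :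
    polarTransform (randersMetric kleinMetric funkForm) x
      (fun i => ℓ (EuclideanSpace.single i 1)) ≤ ENNReal.ofReal (‖ℓ‖ - ℓ x) := by
  refine iSup₂_le fun y _ => ENNReal.ofReal_le_ofReal ?_
  set F := randersMetric kleinMetric funkForm x y
  have hF : 0 ≤ F := randersMetric_kleinMetric_funkForm_nonneg hx y
  have hℓx : ℓ x ≤ ‖ℓ‖ := (le_abs_self _).trans
    (ℓ.le_of_opNorm_le_of_le le_rfl (mem_unitBall.1 hx).le |>.trans_eq (mul_one _))
  have hℓy : ∑ i, ℓ (EuclideanSpace.single i 1) * y i = ℓ y := by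
    conv_rhs => rw [← (EuclideanSpace.basisFun (Fin d) ℝ).sum_repr y]
    simp only [map_sum, map_smul, EuclideanSpace.basisFun_repr, EuclideanSpace.basisFun_apply,
      smul_eq_mul, mul_comm]
  have hunit : F * ℓ x + ℓ y ≤ ‖ℓ‖ * F := calc
    F * ℓ x + ℓ y = ℓ (F • x + y) := by rw [map_add, map_smul, smul_eq_mul]
    _ ≤ ‖ℓ‖ * ‖F • x + y‖ := (le_abs_self _).trans (ℓ.le_opNorm _)
    _ = ‖ℓ‖ * F := by rw [norm_randersMetric_smul_add hx]
  rw [hℓy]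
  exact div_le_of_le_mul₀ hF (sub_nonneg.2 hℓx) (by linarith)

end PolarTransform

/-! ### Weak derivatives of locally Lipschitz functions -/

section LocallyLipschitz

variable {Ω : Set (E d)} {u : E d → ℝ}

lemma exists_norm_fderiv_le_of_isCompact (hΩ : IsOpen Ω) (hu : LocallyLipschitzOn Ω u)
    {K : Set (E d)} (hK : IsCompact K) (hKΩ : K ⊆ Ω) : ∃ C : ℝ, ∀ x ∈ K, ‖fderiv ℝ u x‖ ≤ C := by
  obtain ⟨K', hK', hKK', hK'Ω⟩ := exists_compact_between hK hΩ hKΩ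
  obtain ⟨C, hC⟩ := (hu.mono hK'Ω).exists_lipschitzOnWith_of_compact hK'
  exact ⟨C, fun x hx => norm_fderiv_le_of_lipschitzOn ℝ (mem_interior_iff_mem_nhds.1 (hKK' hx)) hC⟩

lemma memLp_restrict_of_isCompact (hu : LocallyLipschitzOn Ω u) {K : Set (E d)}
    (hK : IsCompact K) (hKΩ : K ⊆ Ω) (p : ℝ≥0∞) : MemLp u p (volume.restrict K) := by
  have : IsFiniteMeasure (volume.restrict K) := ⟨by simpa using hK.measure_lt_top⟩
  have huK := hu.continuousOn.mono hKΩ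
  obtain ⟨C, hC⟩ := hK.exists_bound_of_continuousOn huK
  refine .of_bound (huK.aestronglyMeasurable hK.measurableSet) C ?_
  filter_upwards [ae_restrict_mem hK.measurableSet] with x hx using hC x hx

lemma memLp_pderiv_restrict_of_isCompact (hΩ : IsOpen Ω) (hu : LocallyLipschitzOn Ω u)
    {K : Set (E d)} (hK : IsCompact K) (hKΩ : K ⊆ Ω) (p : ℝ≥0∞) (i : Fin d) :
    MemLp (pderiv i u) p (volume.restrict K) := by
  have : IsFiniteMeasure (volume.restrict K) := ⟨by simpa using hK.measure_lt_top⟩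
  obtain ⟨C, hC⟩ := exists_norm_fderiv_le_of_isCompact hΩ hu hK hKΩ
  refine .of_bound (measurable_fderiv_apply_const ℝ u _).aestronglyMeasurable C ?_
  filter_upwards [ae_restrict_mem hK.measurableSet] with x hx
  refine ((fderiv ℝ u x).le_of_opNorm_le (hC x hx) _).trans_eq ?_
  rw [PiLp.norm_single, norm_one, mul_one]

lemma integral_mul_pderiv_of_lipschitzWith {C : ℝ≥0} (hu : LipschitzWith C u) {φ : E d → ℝ}
    (hφ : ContDiff ℝ 1 φ) (hφc : HasCompactSupport φ) (i : Fin d) :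
    ∫ x, u x * pderiv i φ x = - ∫ x, pderiv i u x * φ x := by
  obtain ⟨D, hD⟩ := ContDiff.lipschitzWith_of_hasCompactSupport hφc hφ one_ne_zero
  have hparts := hu.integral_lineDeriv_mul_eq (μ := volume) hD hφc (EuclideanSpace.single i 1)
  have hderiv : ∫ x, lineDeriv ℝ u x (EuclideanSpace.single i 1) * φ x =
      ∫ x, pderiv i u x * φ x := by
    refine integral_congr_ae ?_
    filter_upwards [hu.ae_differentiableAt (μ := volume)] with x hx
    rw [hx.lineDeriv_eq_fderiv, pderiv]
  rw [← hderiv, hparts, ← integral_neg]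
  refine integral_congr_ae (.of_forall fun x => ?_)
  simp only [(hφ.differentiable one_ne_zero x).lineDeriv_eq_fderiv, map_neg, pderiv]
  ring

lemma pderiv_eq_zero_of_notMem_tsupport {φ : E d → ℝ} {x : E d} (hx : x ∉ tsupport φ)
    (i : Fin d) : pderiv i φ x = 0 := by
  rw [pderiv, fderiv_of_notMem_tsupport ℝ hx, _root_.zero_apply]

lemma integral_mul_pderiv_of_lipschitzOnWith {V : Set (E d)} {C : ℝ≥0}
    (hu : LipschitzOnWith C u V) {φ : E d → ℝ} (hφ : ContDiff ℝ 1 φ) (hφc : HasCompactSupport φ)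
    (hφV : tsupport φ ⊆ interior V) (i : Fin d) :
    ∫ x, u x * pderiv i φ x = - ∫ x, pderiv i u x * φ x := by
  obtain ⟨v, hv, huv⟩ := hu.extend_real
  have hmul : ∀ x, u x * pderiv i φ x = v x * pderiv i φ x := fun x => by
    by_cases hx : x ∈ tsupport φ
    · rw [huv (interior_subset (hφV hx))]
    · rw [pderiv_eq_zero_of_notMem_tsupport hx, mul_zero, mul_zero]
  have hderiv : ∀ x, pderiv i u x * φ x = pderiv i v x * φ x := fun x => by
    by_cases hx : x ∈ tsupport φ
    · have : u =ᶠ[𝓝 x] v := huv.eventuallyEq_of_mem (mem_interior_iff_mem_nhds.1 (hφV hx))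
      rw [pderiv, pderiv, this.fderiv_eq]
    · rw [image_eq_zero_of_notMem_tsupport hx, mul_zero, mul_zero]
  simp only [hmul, hderiv]
  exact integral_mul_pderiv_of_lipschitzWith hv hφ hφc i

lemma hasWeakDeriv_of_locallyLipschitzOn (hΩ : IsOpen Ω) (hu : LocallyLipschitzOn Ω u) :
    HasWeakDeriv Ω u (fun x i => pderiv i u x) where
  locallyIntegrable := (locallyIntegrableOn_iff hΩ.isLocallyClosed).2 fun _ hKΩ hK =>
    memLp_one_iff_integrable.1 (memLp_restrict_of_isCompact hu hK hKΩ 1)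
  locallyIntegrable_deriv i := (locallyIntegrableOn_iff hΩ.isLocallyClosed).2 fun _ hKΩ hK =>
    memLp_one_iff_integrable.1 (memLp_pderiv_restrict_of_isCompact hΩ hu hK hKΩ 1 i)
  integral_eq φ hφ hφc hφΩ i := by
    obtain ⟨K, hK, hφK, hKΩ⟩ := exists_compact_between hφc.isCompact hΩ hφΩ
    obtain ⟨C, hC⟩ := (hu.mono hKΩ).exists_lipschitzOnWith_of_compact hK
    rw [setIntegral_eq_integral_of_forall_compl_eq_zero fun x hx => by
        rw [pderiv_eq_zero_of_notMem_tsupport (mt (@hφΩ x) hx), mul_zero],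
      setIntegral_eq_integral_of_forall_compl_eq_zero fun x hx => by
        rw [image_eq_zero_of_notMem_tsupport (mt (@hφΩ x) hx), mul_zero]]
    exact integral_mul_pderiv_of_lipschitzOnWith hC (hφ.of_le (by simp)) hφc hφK i

lemma memSobolevLoc_of_locallyLipschitzOn (hΩ : IsOpen Ω) (hu : LocallyLipschitzOn Ω u) (p : ℝ) :
    MemSobolevLoc Ω p u :=
  ⟨_, hasWeakDeriv_of_locallyLipschitzOn hΩ hu, fun _ hKΩ hK =>
    ⟨memLp_restrict_of_isCompact hu hK hKΩ _,
      memLp_pderiv_restrict_of_isCompact hΩ hu hK hKΩ _⟩⟩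

lemma sobolevNorm_kleinMetric_funkForm_le (hu : LocallyLipschitzOn (unitBall d) u) {p : ℝ}
    (hp : 0 ≤ p) :
    sobolevNorm (unitBall d) kleinMetric funkForm p u ≤
      ((∫⁻ x in unitBall d, ENNReal.ofReal (‖fderiv ℝ u x‖ - fderiv ℝ u x x) ^ p)
        + ∫⁻ x in unitBall d, ‖u x‖ₑ ^ p) ^ (1 / p) := by
  refine (iInf₂_le _ (hasWeakDeriv_of_locallyLipschitzOn isOpen_unitBall hu)).trans ?_
  rw [randersVolume_kleinMetric_funkForm]
  refine ENNReal.rpow_le_rpow (add_le_add_left ?_ _) (by positivity)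
  exact setLIntegral_mono' isOpen_unitBall.measurableSet fun x hx =>
    ENNReal.rpow_le_rpow (polarTransform_kleinMetric_funkForm_le hx (fderiv ℝ u x)) hp

end LocallyLipschitz

section Smoothing

lemma lipschitzWith_mul_sub {α : Type*} [PseudoMetricSpace α] {χ u : α → ℝ} {K L r : ℝ≥0} {x₀ : α}
    (hχ : LipschitzWith K χ) (hχ_le : ∀ x, |χ x| ≤ 1)
    (hχ_zero : ∀ x ∉ Metric.closedBall x₀ r, χ x = 0)
    (hu : LipschitzOnWith L u (Metric.closedBall x₀ r)) :
    LipschitzWith (L + K * (L * r)) (fun x => χ x * (u x - u x₀)) := by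
  have hx₀ : x₀ ∈ Metric.closedBall x₀ (r : ℝ) := Metric.mem_closedBall_self r.2
  refine LipschitzWith.of_dist_le_mul fun x y => ?_
  wlog hy : y ∈ Metric.closedBall x₀ (r : ℝ) generalizing x y
  · by_cases hx : x ∈ Metric.closedBall x₀ (r : ℝ)
    · rw [dist_comm, dist_comm x]
      exact this y x hx
    · simp only [hχ_zero x hx, hχ_zero y hy, zero_mul, dist_self]
      positivity
  have huy : |u y - u x₀| ≤ L * r :=
    (hu.dist_le_mul y hy x₀ hx₀).trans (by gcongr; exact hy)
  have hχxy : |χ x - χ y| ≤ K * dist x y := hχ.dist_le_mul x y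
  have hux : |χ x * (u x - u y)| ≤ L * dist x y := by
    by_cases hx : x ∈ Metric.closedBall x₀ (r : ℝ)
    · rw [abs_mul]
      exact (mul_le_of_le_one_left (abs_nonneg _) (hχ_le x)).trans (hu.dist_le_mul x hx y hy)
    · rw [hχ_zero x hx, zero_mul, abs_zero]
      positivity
  calc |χ x * (u x - u x₀) - χ y * (u y - u x₀)|
      = |χ x * (u x - u y) + (χ x - χ y) * (u y - u x₀)| := by ring_nf
    _ ≤ |χ x * (u x - u y)| + |χ x - χ y| * |u y - u x₀| :=
        (abs_add_le _ _).trans_eq (by rw [abs_mul (χ x - χ y)])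
    _ ≤ L * dist x y + K * dist x y * (L * r) := by gcongr
    _ = _ := by push_cast; ring

variable {p : ℝ} {h u : E d → ℝ} {x₀ : E d}

lemma sobolevNorm_le_of_lipschitzWith {C : ℝ≥0} (hp : 0 < p) (hh : LipschitzWith C h) {M r : ℝ}
    (hM : ∀ x, |h x| ≤ M) (hr : ∀ x ∉ Metric.closedBall x₀ r, h x = 0) :
    sobolevNorm (unitBall d) kleinMetric funkForm p h ≤
      ((ENNReal.ofReal (2 * C) ^ p + ENNReal.ofReal M ^ p) *
        volume (Metric.closedBall x₀ r)) ^ (1 / p) := by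
  have hbound : ∀ {f : E d → ℝ≥0∞} {c : ℝ≥0∞}, (∀ x ∈ unitBall d, f x ≤ c) →
      (∀ x ∉ Metric.closedBall x₀ r, f x = 0) →
      ∫⁻ x in unitBall d, f x ≤ c * volume (Metric.closedBall x₀ r) := fun {f c} hc hf => by
    rw [← lintegral_indicator_const Metric.isClosed_closedBall.measurableSet]
    refine (setLIntegral_mono' isOpen_unitBall.measurableSet fun x hx => ?_).trans
      (setLIntegral_le_lintegral (unitBall d) _)
    by_cases hxr : x ∈ Metric.closedBall x₀ r
    · exact (hc x hx).trans_eq (indicator_of_mem hxr fun _ => c).symm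
    · exact (hf x hxr).trans_le zero_le
  refine (sobolevNorm_kleinMetric_funkForm_le hh.locallyLipschitz.locallyLipschitzOn hp.le).trans ?_
  rw [add_mul]
  refine ENNReal.rpow_le_rpow (add_le_add (hbound (fun x hx => ?_) fun x hx => ?_)
    (hbound (fun x _ => ?_) fun x hx => ?_)) (by positivity)
  · have hderiv := norm_fderiv_le_of_lipschitz ℝ hh (x₀ := x)
    have hradial := (neg_le_abs _).trans
      ((fderiv ℝ h x).le_of_opNorm_le_of_le hderiv (mem_unitBall.1 hx).le)
    gcongr
    linarith
  · have : h =ᶠ[𝓝 x] fun _ => 0 := by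
      filter_upwards [Metric.isClosed_closedBall.isOpen_compl.mem_nhds hx] with z hz using hr z hz
    simp [this.fderiv_eq, hp]
  · rw [Real.enorm_eq_ofReal_abs]
    gcongr
    exact hM x
  · simp [hr x hx, hp]

lemma tendsto_mul_volume_closedBall_rpow [NeZero d] (hp : 0 < p) {c : ℝ≥0∞} (hc : c ≠ ⊤)
    (x₀ : E d) :
    Tendsto (fun r => (c * volume (Metric.closedBall x₀ r)) ^ (1 / p)) (𝓝 0) (𝓝 0) := by
  have hp_inv : 0 < 1 / p := by positivity
  have hthick := tendsto_measure_cthickening_of_isClosed (μ := volume)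
    ⟨1, one_pos, (isCompact_singleton (x := x₀)).cthickening.measure_lt_top.ne⟩ isClosed_singleton
  rw [measure_singleton] at hthick
  have hvol : Tendsto (fun r => volume (Metric.closedBall x₀ r)) (𝓝 0) (𝓝 0) :=
    tendsto_of_tendsto_of_tendsto_of_le_of_le tendsto_const_nhds hthick (fun _ => zero_le)
      fun r => measure_mono (Metric.closedBall_subset_cthickening_singleton x₀ r)
  simpa only [mul_zero, ENNReal.zero_rpow_of_pos hp_inv] using
    (ENNReal.Tendsto.const_mul hvol (.inr hc)).ennrpow_const (1 / p)

lemma exists_cutoff (x₀ : E d) : ∃ K : ℝ≥0, ∀ δ : ℝ≥0, 0 < δ → ∃ χ : E d → ℝ,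
    ContDiff ℝ ∞ χ ∧ LipschitzWith (K / δ) χ ∧ (∀ x, |χ x| ≤ 1) ∧
      (∀ x ∉ Metric.closedBall x₀ δ, χ x = 0) ∧ χ =ᶠ[𝓝 x₀] 1 := by
  let χ : ContDiffBump (0 : E d) := ⟨1 / 2, 1, by norm_num, by norm_num⟩
  obtain ⟨K, hK⟩ := ContDiff.lipschitzWith_of_hasCompactSupport χ.hasCompactSupport
    (χ.contDiff (n := 1)) one_ne_zero
  refine ⟨K, fun δ hδ => ⟨fun x => χ ((δ : ℝ)⁻¹ • (x - x₀)), ?_, ?_, fun x => ?_,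
    fun x hx => ?_, ?_⟩⟩
  · exact χ.contDiff.comp ((contDiff_id.sub contDiff_const).const_smul _)
  · refine LipschitzWith.of_dist_le_mul fun x y => (hK.dist_le_mul _ _).trans_eq ?_
    rw [dist_smul₀, dist_sub_right, NNReal.coe_div, norm_inv, NNReal.norm_eq]
    ring
  · rw [abs_of_nonneg χ.nonneg]
    exact χ.le_one
  · refine χ.zero_of_le_dist ?_
    rw [dist_zero_right, norm_smul, norm_inv, NNReal.norm_eq]
    rw [Metric.mem_closedBall, dist_eq_norm, not_le] at hx
    exact (one_le_inv_mul₀ (NNReal.coe_pos.2 hδ)).2 hx.le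
  · have hlim : Tendsto (fun x => (δ : ℝ)⁻¹ • (x - x₀)) (𝓝 x₀) (𝓝 0) :=
      Continuous.tendsto' (by fun_prop) _ _ (by rw [sub_self, smul_zero])
    exact hlim.eventually χ.eventuallyEq_one

lemma contDiffOn_sub_mul_sub {F : Type*} [NormedAddCommGroup F] [NormedSpace ℝ F] {Ω : Set F}
    (hΩ : IsOpen Ω) {χ u : F → ℝ} {x₀ : F} (hχ : ContDiff ℝ ∞ χ) (hχ_one : χ =ᶠ[𝓝 x₀] 1)
    (hu : ContDiffOn ℝ ∞ u (Ω \ {x₀})) :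
    ContDiffOn ℝ ∞ (fun x => u x - χ x * (u x - u x₀)) Ω := fun x hx => by
  refine ContDiffAt.contDiffWithinAt ?_
  rcases eq_or_ne x x₀ with rfl | hne
  · refine (contDiffAt_const (c := u x)).congr_of_eventuallyEq ?_
    filter_upwards [hχ_one] with z hz
    rw [hz, Pi.one_apply]
    ring
  · have hux := hu.contDiffAt ((hΩ.sdiff isClosed_singleton).mem_nhds ⟨hx, hne⟩)
    exact hux.sub (hχ.contDiffAt.mul (hux.sub contDiffAt_const))

lemma exists_contDiffOn_lipschitzWith_sub {Ω : Set (E d)} (hΩ : IsOpen Ω) (hx₀ : x₀ ∈ Ω)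
    (hu : LocallyLipschitzOn Ω u) (hu_smooth : ContDiffOn ℝ ∞ u (Ω \ {x₀})) :
    ∃ C : ℝ≥0, ∀ᶠ δ in 𝓝[>] (0 : ℝ), ∃ φ : E d → ℝ, ContDiffOn ℝ ∞ φ Ω ∧
      LipschitzWith C (u - φ) ∧ (∀ x, |(u - φ) x| ≤ C * δ) ∧
      ∀ x ∉ Metric.closedBall x₀ δ, (u - φ) x = 0 := by
  obtain ⟨L, V, hV, hL⟩ := hu hx₀
  rw [hΩ.nhdsWithin_eq hx₀] at hV
  obtain ⟨ρ, hρ, hρV⟩ := Metric.nhds_basis_closedBall.mem_iff.1 hV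
  obtain ⟨K, hK⟩ := exists_cutoff x₀
  refine ⟨L + K * L, ?_⟩
  filter_upwards [Ioc_mem_nhdsGT hρ] with δ ⟨hδ_pos, hδρ⟩
  lift δ to ℝ≥0 using hδ_pos.le
  obtain ⟨χ, hχ, hχK, hχ_le, hχ_zero, hχ_one⟩ := hK δ hδ_pos
  have hC : L + K / δ * (L * δ) = L + K * L := by
    rw [mul_left_comm, div_mul_cancel₀ K (NNReal.coe_pos.1 hδ_pos).ne', mul_comm L K]
  have hlip : LipschitzWith (L + K * L) (fun x => χ x * (u x - u x₀)) :=
    hC ▸ lipschitzWith_mul_sub hχK hχ_le hχ_zero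
      (hL.mono ((Metric.closedBall_subset_closedBall hδρ).trans hρV))
  have hsub : u - (fun x => u x - χ x * (u x - u x₀)) = fun x => χ x * (u x - u x₀) := by
    funext x
    rw [Pi.sub_apply, sub_sub_cancel]
  refine ⟨_, contDiffOn_sub_mul_sub hΩ hχ hχ_one hu_smooth, hsub ▸ hlip, fun x => ?_,
    fun x hx => ?_⟩
  · rw [hsub]
    by_cases hx : x ∈ Metric.closedBall x₀ (δ : ℝ)
    · have := hlip.dist_le_mul x x₀
      rw [sub_self, mul_zero, dist_zero_right, Real.norm_eq_abs] at this
      exact this.trans (by gcongr; exact hx)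
    · simp only [hχ_zero x hx, zero_mul, abs_zero]
      positivity
  · simp only [hsub, hχ_zero x hx, zero_mul]

lemma exists_contDiffOn_sobolevNorm_sub_lt [NeZero d] (hp : 0 < p) (hx₀ : x₀ ∈ unitBall d)
    (hu : LocallyLipschitzOn (unitBall d) u) (hu_smooth : ContDiffOn ℝ ∞ u (unitBall d \ {x₀}))
    {ε : ℝ≥0∞} (hε : 0 < ε) :
    ∃ φ : E d → ℝ, ContDiffOn ℝ ∞ φ (unitBall d) ∧
      sobolevNorm (unitBall d) kleinMetric funkForm p (fun x => u x - φ x) < ε ∧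
      sobolevNorm (unitBall d) kleinMetric funkForm p (fun x => φ x - u x) < ε := by
  obtain ⟨C, hC⟩ := exists_contDiffOn_lipschitzWith_sub isOpen_unitBall hx₀ hu hu_smooth
  have hlim := tendsto_mul_volume_closedBall_rpow hp (x₀ := x₀)
    (c := ENNReal.ofReal (2 * C) ^ p + ENNReal.ofReal C ^ p) (ENNReal.add_ne_top.2
      ⟨ENNReal.rpow_ne_top_of_nonneg hp.le ENNReal.ofReal_ne_top,
        ENNReal.rpow_ne_top_of_nonneg hp.le ENNReal.ofReal_ne_top⟩)
  obtain ⟨δ, ⟨φ, hφ, hlip, hle, hzero⟩, hδε, -, hδ_le⟩ :=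
    (hC.and (((hlim.mono_left nhdsWithin_le_nhds).eventually_lt_const hε).and
      (Ioc_mem_nhdsGT one_pos))).exists
  have hle_C : ∀ x, |(u - φ) x| ≤ C := fun x =>
    (hle x).trans (mul_le_of_le_one_right C.2 hδ_le)
  refine ⟨φ, hφ, (sobolevNorm_le_of_lipschitzWith hp hlip hle_C hzero).trans_lt hδε, ?_⟩
  have hneg : (fun x => φ x - u x) = -(u - φ) := (neg_sub u φ).symm
  rw [hneg]
  exact (sobolevNorm_le_of_lipschitzWith hp hlip.neg
    (fun x => (abs_neg _).trans_le (hle_C x))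
    fun x hx => neg_eq_zero.2 (hzero x hx)).trans_lt hδε

lemma memSobolev_of_contDiffOn_diff_singleton [NeZero d] (hp : 0 < p) (hx₀ : x₀ ∈ unitBall d)
    (hu : LocallyLipschitzOn (unitBall d) u) (hu_smooth : ContDiffOn ℝ ∞ u (unitBall d \ {x₀}))
    (hu_fin : sobolevNorm (unitBall d) kleinMetric funkForm p u < ⊤) :
    MemSobolev (unitBall d) kleinMetric funkForm p u where
  memLoc := memSobolevLoc_of_locallyLipschitzOn isOpen_unitBall hu p
  norm_lt_top := hu_fin
  mem_closure _ hε := exists_contDiffOn_sobolevNorm_sub_lt hp hx₀ hu hu_smooth hε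

end Smoothing

/-! ### The extremal function -/

section Radial

lemma locallyLipschitzOn_comp_norm {F : Type*} [SeminormedAddCommGroup F] {k : ℝ → ℝ} {r : ℝ}
    (hk : LocallyLipschitzOn (Iio r) k) :
    LocallyLipschitzOn (Metric.ball 0 r) (fun x : F => k ‖x‖) := fun x hx => by
  have hmaps : MapsTo (norm : F → ℝ) (Metric.ball 0 r) (Iio r) := fun _ => mem_ball_zero_iff.1
  obtain ⟨K, t, ht, hK⟩ := hk (hmaps hx)
  exact ⟨K * 1, _, (continuous_norm.continuousWithinAt.tendsto_nhdsWithin hmaps) ht,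
    hK.comp lipschitzWith_one_norm.lipschitzOnWith fun _ => id⟩

lemma norm_fderiv_comp_norm_sub {F : Type*} [NormedAddCommGroup F] [InnerProductSpace ℝ F]
    {k : ℝ → ℝ} {k' : ℝ} {x : F} (hx : x ≠ 0) (hk : HasDerivAt k k' ‖x‖) :
    ‖fderiv ℝ (fun z => k ‖z‖) x‖ - fderiv ℝ (fun z => k ‖z‖) x x = |k'| - k' * ‖x‖ := by
  have : Nontrivial F := ⟨x, 0, hx⟩
  have hnorm : DifferentiableAt ℝ (‖·‖) x := (contDiffAt_norm ℝ hx).differentiableAt one_ne_zero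
  have hcomp : fderiv ℝ (fun z => k ‖z‖) x = k' • fderiv ℝ (‖·‖) x :=
    (hk.comp_hasFDerivAt x hnorm.hasFDerivAt).fderiv
  rw [hcomp, norm_smul, norm_fderiv_norm hnorm, mul_one, Real.norm_eq_abs, _root_.smul_apply,
    hnorm.fderiv_norm_self, smul_eq_mul]

end Radial

section Profile

variable {t s : ℝ}

/-- The profile `s (1 - s)^(-1/t)` of the radial function `funkFunction t`. -/
noncomputable def funkProfile (t s : ℝ) : ℝ := s * (1 - s) ^ (-(1 / t))

lemma funkFunction_eq_funkProfile_norm (t : ℝ) :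
    funkFunction (d := d) t = fun x => funkProfile t ‖x‖ := rfl

lemma contDiffOn_funkProfile (t : ℝ) : ContDiffOn ℝ ∞ (funkProfile t) (Iio 1) :=
  contDiffOn_id.mul ((contDiffOn_const.sub contDiffOn_id).rpow_const_of_ne
    fun _ hs => (sub_pos.2 hs).ne')

lemma hasDerivAt_funkProfile (ht : t ≠ 0) (hs : s < 1) :
    HasDerivAt (funkProfile t) ((1 - s) ^ (-(1 / t)) * (1 + s / (t * (1 - s)))) s := by
  have hs' : 1 - s ≠ 0 := (sub_pos.2 hs).ne'
  refine ((hasDerivAt_id' s).mul (((hasDerivAt_id' s).const_sub 1).rpow_const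
    (p := -(1 / t)) (.inl hs'))).congr_deriv ?_
  rw [Real.rpow_sub_one hs']
  field_simp

lemma abs_deriv_funkProfile_sub_le (ht : 0 < t) (hs₀ : 0 ≤ s) (hs : s < 1) :
    |deriv (funkProfile t) s| - deriv (funkProfile t) s * s ≤
      (1 + 1 / t) * (1 - s) ^ (-(1 / t)) := by
  have hs' : 0 < 1 - s := sub_pos.2 hs
  have hst : s / t ≤ 1 / t := by gcongr
  rw [(hasDerivAt_funkProfile ht.ne' hs).deriv, abs_of_nonneg (by positivity)]
  calc (1 - s) ^ (-(1 / t)) * (1 + s / (t * (1 - s))) -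
        (1 - s) ^ (-(1 / t)) * (1 + s / (t * (1 - s))) * s
      = ((1 - s) + s / t) * (1 - s) ^ (-(1 / t)) := by field_simp
    _ ≤ (1 + 1 / t) * (1 - s) ^ (-(1 / t)) := by gcongr; linarith

lemma funkFunction_nonneg (t : ℝ) {x : E d} (hx : x ∈ unitBall d) : 0 ≤ funkFunction t x :=
  mul_nonneg (norm_nonneg x) (Real.rpow_nonneg (sub_pos.2 (mem_unitBall.1 hx)).le _)

lemma funkFunction_le (t : ℝ) {x : E d} (hx : x ∈ unitBall d) :
    funkFunction t x ≤ (1 - ‖x‖) ^ (-(1 / t)) :=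
  mul_le_of_le_one_left (Real.rpow_nonneg (sub_pos.2 (mem_unitBall.1 hx)).le _)
    (mem_unitBall.1 hx).le

lemma locallyLipschitzOn_funkFunction (t : ℝ) :
    LocallyLipschitzOn (unitBall d) (funkFunction t) :=
  locallyLipschitzOn_comp_norm
    (((contDiffOn_funkProfile t).of_le (by simp)).locallyLipschitzOn (convex_Iio 1))

lemma contDiffOn_funkFunction (t : ℝ) :
    ContDiffOn ℝ ∞ (funkFunction t) (unitBall d \ {0}) := fun x ⟨hx, hx₀⟩ =>
  (((contDiffOn_funkProfile t).contDiffAt (isOpen_Iio.mem_nhds (mem_unitBall.1 hx))).comp x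
    (contDiffAt_norm ℝ hx₀)).contDiffWithinAt

end Profile

section Integrability

variable [NeZero d] {p t : ℝ}

lemma integrableOn_one_sub_norm_rpow {a : ℝ} (ha : -1 < a) :
    IntegrableOn (fun x : E d => (1 - ‖x‖) ^ a) (unitBall d) := by
  have hrpow : IntegrableOn (fun s : ℝ => (1 - s) ^ a) (Ioo 0 1) := by
    have := (intervalIntegral.intervalIntegrable_rpow' (a := 1) (b := 0) ha).comp_sub_left 1
    rwa [sub_self, sub_zero, intervalIntegrable_iff_integrableOn_Ioo_of_le zero_le_one] at this
  refine (integrableOn_fun_norm_addHaar volume).2 (Integrable.bdd_mul (c := 1) hrpow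
    (by fun_prop) ?_)
  filter_upwards [ae_restrict_mem measurableSet_Ioo] with s hs
  rw [norm_pow, Real.norm_of_nonneg hs.1.le]
  exact pow_le_one₀ hs.1.le hs.2.le

lemma lintegral_ofReal_rpow_lt_top (hp : 0 < p) (hpt : p < t) {f : E d → ℝ} {c : ℝ}
    (hf : ∀ᵐ x ∂volume.restrict (unitBall d), f x ≤ c * (1 - ‖x‖) ^ (-(1 / t))) :
    ∫⁻ x in unitBall d, ENNReal.ofReal (f x) ^ p < ⊤ := by
  have ha : -1 < -(1 / t) * p := by
    have := (div_lt_one (hp.trans hpt)).2 hpt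
    rw [neg_mul, one_div_mul_eq_div]
    linarith
  refine (lintegral_mono_ae (g := fun x => ENNReal.ofReal c ^ p *
    ENNReal.ofReal ((1 - ‖x‖) ^ (-(1 / t) * p))) ?_).trans_lt ?_
  · filter_upwards [hf, ae_restrict_mem isOpen_unitBall.measurableSet] with x hfx hx
    have hx' : 0 ≤ 1 - ‖x‖ := (sub_pos.2 (mem_unitBall.1 hx)).le
    have hr := Real.rpow_nonneg hx' (-(1 / t))
    rw [Real.rpow_mul hx', ← ENNReal.ofReal_rpow_of_nonneg hr hp.le,
      ← ENNReal.mul_rpow_of_nonneg _ _ hp.le, ← ENNReal.ofReal_mul' hr]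
    gcongr
  · rw [lintegral_const_mul' _ _ (ENNReal.rpow_ne_top_of_nonneg hp.le ENNReal.ofReal_ne_top)]
    exact ENNReal.mul_lt_top
      (ENNReal.rpow_lt_top_of_nonneg hp.le ENNReal.ofReal_ne_top)
      (integrableOn_one_sub_norm_rpow ha).lintegral_lt_top

lemma sobolevNorm_funkFunction_lt_top (hp : 0 < p) (hpt : p < t) :
    sobolevNorm (unitBall d) kleinMetric funkForm p (funkFunction t) < ⊤ := by
  have ht : 0 < t := hp.trans hpt
  refine (sobolevNorm_kleinMetric_funkForm_le (locallyLipschitzOn_funkFunction t)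
    hp.le).trans_lt (ENNReal.rpow_lt_top_of_nonneg (by positivity) (ENNReal.add_ne_top.2
      ⟨(lintegral_ofReal_rpow_lt_top hp hpt (c := 1 + 1 / t) ?_).ne, ?_⟩))
  · filter_upwards [ae_restrict_mem isOpen_unitBall.measurableSet,
      ae_restrict_of_ae (Measure.ae_ne volume (0 : E d))] with x hx hx₀
    rw [funkFunction_eq_funkProfile_norm, norm_fderiv_comp_norm_sub hx₀
      (hasDerivAt_funkProfile ht.ne' (mem_unitBall.1 hx)).differentiableAt.hasDerivAt]
    exact abs_deriv_funkProfile_sub_le ht (norm_nonneg x) (mem_unitBall.1 hx)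
  · simp only [Real.enorm_eq_ofReal_abs]
    refine (lintegral_ofReal_rpow_lt_top hp hpt (c := 1) ?_).ne
    filter_upwards [ae_restrict_mem isOpen_unitBall.measurableSet] with x hx
    rw [abs_of_nonneg (funkFunction_nonneg t hx), one_mul]
    exact funkFunction_le t hx

lemma memSobolev_funkFunction (hp : 0 < p) (hpt : p < t) :
    MemSobolev (unitBall d) kleinMetric funkForm p (funkFunction t) :=
  memSobolev_of_contDiffOn_diff_singleton hp (Metric.mem_ball_self one_pos)
    (locallyLipschitzOn_funkFunction t) (contDiffOn_funkFunction t)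
    (sobolevNorm_funkFunction_lt_top hp hpt)

lemma not_integrableOn_funkFunction_rpow (ht : 0 < t) :
    ¬ IntegrableOn (fun x : E d => funkFunction t x ^ t) (unitBall d) := fun hint => by
  have hradial := ((integrableOn_fun_norm_addHaar (volume : Measure (E d))
    (f := fun s => funkProfile t s ^ t)).1 hint).mono_set
      (Ioo_subset_Ioo_left (show (0 : ℝ) ≤ 1 / 2 by norm_num))
  set n := Module.finrank ℝ (E d) - 1
  have hinv : IntegrableOn (fun s : ℝ => (s - 1)⁻¹) (Ioo (1 / 2) 1) := by
    refine (hradial.const_mul (2 ^ n * 2 ^ t)).mono' (by fun_prop) ?_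
    filter_upwards [ae_restrict_mem measurableSet_Ioo] with s hs
    have hs₁ : 0 < 1 - s := sub_pos.2 hs.2
    have hs₀ : 0 < s := by linarith [hs.1]
    have hs₂ : 1 ≤ 2 * s := by linarith [hs.1]
    have hprofile : funkProfile t s ^ t = s ^ t * (1 - s)⁻¹ := by
      rw [funkProfile, Real.mul_rpow hs₀.le (by positivity), ← Real.rpow_mul hs₁.le, neg_mul,
        one_div_mul_cancel ht.ne', Real.rpow_neg_one]
    calc ‖(s - 1)⁻¹‖ = (1 - s)⁻¹ := by
          rw [norm_inv, Real.norm_eq_abs, abs_sub_comm, abs_of_pos hs₁]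
      _ ≤ (2 * s) ^ n * (2 * s) ^ t * (1 - s)⁻¹ :=
          le_mul_of_one_le_left (inv_nonneg.2 hs₁.le) (one_le_mul_of_one_le_of_one_le
            (one_le_pow₀ hs₂) (Real.one_le_rpow hs₂ ht.le))
      _ = 2 ^ n * 2 ^ t * (s ^ n • funkProfile t s ^ t) := by
          rw [hprofile, smul_eq_mul, mul_pow, Real.mul_rpow zero_le_two hs₀.le]
          ring
  rw [← intervalIntegrable_iff_integrableOn_Ioo_of_le (by norm_num),
    intervalIntegrable_sub_inv_iff] at hinv
  exact hinv.elim (by norm_num) (· right_mem_uIcc)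

lemma eLpNorm_funkFunction_eq_top (ht : 0 < t) {q : ℝ≥0∞} (hq : ENNReal.ofReal t ≤ q) :
    eLpNorm (funkFunction t) q (randersVolume (unitBall d) kleinMetric funkForm) = ⊤ := by
  rw [randersVolume_kleinMetric_funkForm]
  have : IsFiniteMeasure (volume.restrict (unitBall d)) :=
    isFiniteMeasure_restrict.2 measure_ball_lt_top.ne
  by_contra hfin
  have hmeas : Measurable (funkFunction (d := d) t) := by unfold funkFunction; fun_prop
  have hLt : MemLp (funkFunction t) (ENNReal.ofReal t) (volume.restrict (unitBall d)) :=
    MemLp.mono_exponent ⟨hmeas.aestronglyMeasurable, lt_top_iff_ne_top.2 hfin⟩ hq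
  refine not_integrableOn_funkFunction_rpow ht ((hLt.integrable_norm_rpow
    (ENNReal.ofReal_pos.2 ht).ne' ENNReal.ofReal_ne_top).congr ?_)
  filter_upwards [ae_restrict_mem isOpen_unitBall.measurableSet] with x hx
  rw [Real.norm_of_nonneg (funkFunction_nonneg t hx), ENNReal.toReal_ofReal ht.le]

end Integrability

lemma IsAdmissible.exists_exponent [NeZero d] {p : ℝ} {q : ℝ≥0∞} (h : IsAdmissible d p q) :
    ∃ t : ℝ, p < t ∧ ENNReal.ofReal t ≤ q ∧ (q ≠ ⊤ → t = (p + q.toReal) / 2) ∧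
      (q = ⊤ → t = p ^ 2 / d) := by
  obtain ⟨hp, h⟩ := h
  rcases eq_or_ne q ⊤ with rfl | hq
  · have hdp : (d : ℝ) < p := by simpa using h
    have hd : (0 : ℝ) < d := Nat.cast_pos.2 (NeZero.pos d)
    refine ⟨p ^ 2 / d, ?_, le_top, fun h => (h rfl).elim, fun _ => rfl⟩
    rw [lt_div_iff₀ hd]
    nlinarith
  · have hpq : ENNReal.ofReal p < q := by
      rcases h with ⟨-, hpq, -⟩ | ⟨-, hpq, -⟩ | ⟨-, hq_top⟩
      exacts [hpq, hpq, (hq hq_top).elim]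
    have hpq' : p < q.toReal := (ENNReal.ofReal_lt_iff_lt_toReal (by linarith) hq).1 hpq
    refine ⟨(p + q.toReal) / 2, by linarith, ?_, fun _ => rfl, fun h => (hq h).elim⟩
    rw [ENNReal.ofReal_le_iff_le_toReal hq]
    linarith

lemma not_continuouslyEmbeds {Ω : Set (E d)} {g : E d → Matrix (Fin d) (Fin d) ℝ}
    {β : E d → Fin d → ℝ} {p : ℝ} {q : ℝ≥0∞} {u : E d → ℝ} (hu : MemSobolev Ω g β p u)
    (hu_top : eLpNorm u q (randersVolume Ω g β) = ⊤) : ¬ ContinuouslyEmbeds Ω g β p q :=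
  fun ⟨_, hC⟩ => (ENNReal.mul_lt_top ENNReal.coe_lt_top hu.norm_lt_top).ne
    (top_le_iff.1 (hu_top ▸ hC u hu))

end FunkModel

open FunkModel in
theorem mainTheorem6_general (d : ℕ) [NeZero d] :
    IsRandersSpace (unitBall d) kleinMetric funkForm ∧
    (∀ x ∈ unitBall d, ∀ y : E d, funkMetric x y = randersMetric kleinMetric funkForm x y) ∧
    IsHadamard (unitBall d) kleinMetric ∧
    IsLUB (formNorm kleinMetric funkForm '' unitBall d) 1 ∧
    reversibility (unitBall d) funkMetric = ⊤ ∧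
    ∀ (p t : ℝ) (q : ℝ≥0∞), 0 < p → p < t → ENNReal.ofReal t ≤ q →
      MemSobolev (unitBall d) kleinMetric funkForm p (funkFunction t) ∧
      eLpNorm (funkFunction t) q (randersVolume (unitBall d) kleinMetric funkForm) = ⊤ ∧
      ¬ ContinuouslyEmbeds (unitBall d) kleinMetric funkForm p q := by
  refine ⟨isRandersSpace_kleinMetric_funkForm, fun x hx y => funkMetric_eq_randersMetric hx y,
    isHadamard_kleinMetric, isLUB_formNorm_image, reversibility_funkMetric,
    fun p t q hp hpt htq => ?_⟩
  have hmem := memSobolev_funkFunction (d := d) hp hpt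
  have htop := eLpNorm_funkFunction_eq_top (d := d) (hp.trans hpt) htq
  exact ⟨hmem, htop, not_continuouslyEmbeds hmem htop⟩

theorem mainTheorem6 (d : ℕ) (hd : 2 ≤ d) :
    FunkModel.IsRandersSpace (FunkModel.unitBall d) FunkModel.kleinMetric FunkModel.funkForm ∧
    (∀ x ∈ FunkModel.unitBall d, ∀ y : FunkModel.E d,
      FunkModel.funkMetric x y =
        FunkModel.randersMetric FunkModel.kleinMetric FunkModel.funkForm x y) ∧
    FunkModel.IsHadamard (FunkModel.unitBall d) FunkModel.kleinMetric ∧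
    IsLUB (FunkModel.formNorm FunkModel.kleinMetric FunkModel.funkForm '' FunkModel.unitBall d) 1 ∧
    FunkModel.reversibility (FunkModel.unitBall d) FunkModel.funkMetric = ⊤ ∧
    ∀ (p : ℝ) (q : ℝ≥0∞), FunkModel.IsAdmissible d p q →
      (∃ t : ℝ, 0 < t ∧ (q ≠ ⊤ → t = (p + q.toReal) / 2) ∧ (q = ⊤ → t = p ^ 2 / d) ∧
        FunkModel.MemSobolev (FunkModel.unitBall d) FunkModel.kleinMetric FunkModel.funkForm p
          (FunkModel.funkFunction t) ∧
        eLpNorm (FunkModel.funkFunction t) q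
          (FunkModel.randersVolume (FunkModel.unitBall d) FunkModel.kleinMetric
            FunkModel.funkForm) = ⊤) ∧
      ¬ FunkModel.ContinuouslyEmbeds (FunkModel.unitBall d) FunkModel.kleinMetric
          FunkModel.funkForm p q := by
  have : NeZero d := ⟨by omega⟩
  obtain ⟨hRanders, hFunk, hHadamard, hLUB, hrev, hSobolev⟩ := mainTheorem6_general d
  refine ⟨hRanders, hFunk, hHadamard, hLUB, hrev, fun p q hpq => ?_⟩
  obtain ⟨t, hpt, htq, ht_ne_top, ht_top⟩ := hpq.exists_exponent
  have hp : 0 < p := one_pos.trans hpq.1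
  obtain ⟨hmem, htop, hembed⟩ := hSobolev p t q hp hpt htq
  exact ⟨⟨t, hp.trans hpt, ht_ne_top, ht_top, hmem, htop⟩, hembed⟩
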